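/- All graphs are simple and locally finite. Let $G$ be an infinite connected graph, let $(S_n)_{n\ge 0}$ be the simple random walk on $G$, with law $P^x$ when started at $x$, and assume that $G$ is transient, i.e. $P^x(S_n = x \text{ for infinitely many } n) = 0$ for every $x \in V(G)$. A set $A \subset V(G)$ is a recurrent subset of $G$ if $P^x(S_n \in A \text{ for infinitely many } n) > 0$ for some $x \in V(G)$, and otherwise a transient subset. For $p\in[0,1]$ let $\mathbb{P}_p$ be Bernoulli bond percolation on $G$, in which each edge is independently open with probability $p$; let $C_x$ be the open cluster of $x$, and let $p_c(G) = \inf\{p \in (0,1) : \mathbb{P}_p(|C_x| = \infty) > 0\}$, which does not depend on $x$. For $H \subset V(G)$, regarded as the subgraph of $G$ that it induces, let $\mathcal{U}(H)$ be the random subgraph of $G$ with vertex set $\bigcup_{x \in H} V(C_x)$ and edge set $E(H) \cup \bigcup_{x \in H} E(C_x)$. Let $\mathcal{P}$ be the property of being a recurrent subset (that is, a subgraph of $G$ has property $\mathcal{P}$ if its vertex set is a recurrent subset of $G$), and put \[ p_{c,1}(G,H,\mathcal{P}) = \inf\{p \in [0,1] : \mathbb{P}_p(\mathcal{U}(H)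 \in \mathcal{P}) > 0\}, \qquad p_{c,2}(G,H,\mathcal{P}) = \inf\{p \in [0,1] : \mathbb{P}_p(\mathcal{U}(H) \in \mathcal{P}) = 1\}. \] Infima are taken in $[0,1]$, so $\inf \emptyset = 1$. Then: (i) There is an infinite, connected, locally finite, transient graph $G$ such that for every transient subset $H$ of $G$, \[ 0 < p_c(G) < p_{c,1}(G,H,\mathcal{P}) = 1. \] (ii) There is an infinite, connected, locally finite, transient graph $G$ that has infinite transient subsets and is such that for every infinite transient subset $H$ of $G$, \[ p_{c,2}(G,H,\mathcal{P}) = 0. \] -/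

import Mathlib

open MeasureTheory ProbabilityTheory Filter Set
open scoped ENNReal unitInterval

namespace Enlargement

noncomputable section

/-! ### Simple random walk and recurrent subsets -/

/-- One step of the simple random walk on `G` from `x`: a uniformly chosen neighbour of `x`.
(At a vertex with no neighbour, or with infinitely many, the walk stays put by convention; this
never happens in an infinite connected locally finite graph.) -/
def stepPMF {V : Type*} (G : SimpleGraph V) (x : V) : PMF V := by
  classical
  exact
    if h : ∃ hf : (G.neighborSet x).Finite, hf.toFinset.Nonempty then
      PMF.uniformOfFinset h.choose.toFinset h.choose_spec
    else PMF.pure x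

/-- The transition kernel of the simple random walk on `G` at time `n`, as a kernel from
trajectories up to time `n`: it depends on the current position only. -/
def stepKernel {V : Type*} [MeasurableSpace V] [DiscreteMeasurableSpace V] (G : SimpleGraph V)
    (n : ℕ) : Kernel ((i : Finset.Iic n) → (fun _ : ℕ => V) i) V where
  toFun s := (stepPMF G (s ⟨n, Finset.mem_Iic.2 le_rfl⟩)).toMeasure
  measurable' :=
    (Measurable.of_discrete (f := fun x : V => (stepPMF G x).toMeasure)).comp
      (measurable_pi_apply _)

instance {V : Type*} [MeasurableSpace V] [DiscreteMeasurableSpace V] (G : SimpleGraph V)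
    (n : ℕ) : IsMarkovKernel (stepKernel G n) :=
  ⟨fun s => PMF.toMeasure.isProbabilityMeasure
    (stepPMF G (s ⟨n, Finset.mem_Iic.2 le_rfl⟩))⟩

/-- `P^x`: the law on path space `ℕ → V` of the simple random walk on `G` started at `x`. -/
def srwLaw {V : Type*} [MeasurableSpace V] [DiscreteMeasurableSpace V] (G : SimpleGraph V)
    (x : V) : Measure (ℕ → V) :=
  Kernel.traj (X := fun _ => V) (stepKernel G) 0 (fun _ => x)

/-- `P^x(S_n ∈ A for infinitely many n)`; the vertex set carries the discrete σ-algebra. -/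
def ioProb {V : Type*} (G : SimpleGraph V) (x : V) (A : Set V) : ℝ≥0∞ :=
  letI : MeasurableSpace V := ⊤
  haveI : DiscreteMeasurableSpace V := ⟨fun _ => trivial⟩
  srwLaw G x {S | ∃ᶠ n in atTop, S n ∈ A}

/-- `A` is a recurrent subset of `V(G)`: `P^x(S_n ∈ A i.o.) > 0` for some `x`. -/
def IsRecurrentSubset {V : Type*} (G : SimpleGraph V) (A : Set V) : Prop :=
  ∃ x : V, 0 < ioProb G x A

/-- A transient subset is one that is not recurrent. -/
def IsTransientSubset {V : Type*} (G : SimpleGraph V) (A : Set V) : Prop :=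
  ¬ IsRecurrentSubset G A

/-- `G` is a transient graph: from any vertex, the simple random walk almost surely returns to
its starting point only finitely often. -/
def IsTransientGraph {V : Type*} (G : SimpleGraph V) : Prop :=
  ∀ x : V, ioProb G x {x} = 0

/-! ### Bernoulli bond percolation -/

/-- `ℙ_p` on configurations `{0,1}^{E(G)}`: the edges are independently open (`true`) with
probability `p` and closed (`false`) with probability `1 - p`. -/
def bondMeasure {V : Type*} (G : SimpleGraph V) (p : I) : Measure (G.edgeSet → Bool) :=
  Measure.infinitePi fun _ => bernoulliMeasure true false p

/-- The graph of open edges of a configuration. -/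
def openGraph {V : Type*} (G : SimpleGraph V) (ω : G.edgeSet → Bool) : SimpleGraph V where
  Adj a b := ∃ h : s(a, b) ∈ G.edgeSet, ω ⟨s(a, b), h⟩ = true
  symm := ⟨fun a b h => by rwa [Sym2.eq_swap]⟩
  loopless := ⟨fun a h => G.loopless.irrefl a h.1⟩

/-- The open cluster `C_x`, as a subgraph of `G`. -/
def cluster {V : Type*} (G : SimpleGraph V) (ω : G.edgeSet → Bool) (x : V) : G.Subgraph where
  verts := {y | (openGraph G ω).Reachable x y}
  Adj a b := (openGraph G ω).Reachable x a ∧ (openGraph G ω).Adj a b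
  adj_sub h := h.2.1
  edge_vert h := h.1
  symm := ⟨fun _ _ h => ⟨h.1.trans h.2.reachable, h.2.symm⟩⟩

/-- Hammersley's critical probability `p_c(G)`. The infimum is taken in `[0,1]` (so the infimum
of the empty set is `1`). For connected `G` the condition does not depend on the vertex `x`. -/
def criticalProb {V : Type*} (G : SimpleGraph V) : I :=
  sInf {p : I | 0 < p ∧ p < 1 ∧
    ∃ x : V, 0 < bondMeasure G p {ω | (cluster G ω x).verts.Infinite}}

/-- The enlargement `𝒰_ω(H)`: its vertices are those of the clusters `C_x`, `x ∈ V(H)`, and its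
edges are those of `H` and of these clusters. -/
def enlargement {V : Type*} (G : SimpleGraph V) (ω : G.edgeSet → Bool) (H : G.Subgraph) :
    G.Subgraph where
  verts := ⋃ x ∈ H.verts, (cluster G ω x).verts
  Adj a b := H.Adj a b ∨ ∃ x ∈ H.verts, (cluster G ω x).Adj a b
  adj_sub h := h.elim (fun h => h.adj_sub) fun ⟨_, _, h⟩ => h.adj_sub
  edge_vert {a _} h := by
    rcases h with h | ⟨x, hx, h⟩
    · exact mem_biUnion (t := fun x => (cluster G ω x).verts) h.fst_mem (SimpleGraph.Reachable.refl a)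
    · exact mem_biUnion (t := fun x => (cluster G ω x).verts) hx h.fst_mem
  symm := ⟨fun _ _ h => h.imp (fun h => h.symm) fun ⟨x, hx, h⟩ => ⟨x, hx, h.symm⟩⟩

/-- `p_{c,1}(G, H, 𝒫)`, the infimum being taken in `[0,1]`. -/
def pc1 {V : Type*} (G : SimpleGraph V) (H : G.Subgraph) (P : G.Subgraph → Prop) : I :=
  sInf {p : I | 0 < bondMeasure G p {ω | P (enlargement G ω H)}}

/-- `p_{c,2}(G, H, 𝒫)`, the infimum being taken in `[0,1]`. -/
def pc2 {V : Type*} (G : SimpleGraph V) (H : G.Subgraph) (P : G.Subgraph → Prop) : I :=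
  sInf {p : I | bondMeasure G p {ω | P (enlargement G ω H)} = 1}

/-- The property of being a recurrent subset, for subgraphs of `G`. -/
def BeingRecurrentSubset {V : Type*} (G : SimpleGraph V) (K : G.Subgraph) : Prop :=
  IsRecurrentSubset G K.verts

/-- The subgraph of `G` induced by a set of vertices. -/
def inducedSubgraph {V : Type*} (G : SimpleGraph V) (A : Set V) : G.Subgraph :=
  (⊤ : G.Subgraph).induce A

/-- The standing assumptions on `G`: an infinite, connected, locally finite (simple) graph on which
the simple random walk is transient. -/
structure IsAdmissible {V : Type*} (G : SimpleGraph V) : Prop where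
  infinite : Infinite V
  connected : G.Connected
  locallyFinite : ∀ v : V, (G.neighborSet v).Finite
  transient : IsTransientGraph G

end

end Enlargement

/-! Both examples are lines of cut points, consecutive ones joined by `N n` paths of length two,
with a tree possibly attached at the origin. Everything about the walk is expressed by `hit G A`,
the least superharmonic function that is at least `1` on `A`. The probability of visiting `A`
infinitely often is the limit of the mean of `hit G A (S n)` (`measure_frequently`). Hence
transience passes from `A` to any set on which `hit G A` is bounded below
(`IsTransientSubset.of_le_hit`).

For (i), `N` grows logarithmically and a binary tree is attached whose edges at depth `k` become
chains of `(k + 1) ^ 2` edges. The resistance `∑ (k + 1) ^ 2 / 2 ^ k` of the tree is finite, so the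
graph is transient. The line alone is recurrent, so from it the origin is hit almost surely and the
whole line is a transient subset. For `p < 1` the expected number of entirely open chains, of order
`∑ 2 ^ k * p ^ ((k + 1) ^ 2)`, is finite. Thus, apart from the line and finitely many points, every
vertex of the enlargement of `A` lies with a point of `A` in the star of one junction. Chain lengths
at a junction are comparable, so a Harnack inequality (`le_hit_of_star`) bounds `hit` below by `1 /
36` there, and the enlargement stays transient. The critical probability comes from the line: with
about `log n` parallel paths, a level is blocked with probability a negative power of `n`. By the
Borel–Cantelli lemmas, blocked levels recur for `p ≤ 1 / 2` and cease for `p = 7 / 8`.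

For (ii), `N n = 2 ^ n` and there is no tree. The walk escapes along the line through all later cut
points, so infinitely many cut points form a recurrent set. An infinite transient set therefore
contains infinitely many midpoints, and for every `p > 0` infinitely many of them are joined to a
cut point by an open edge. One midpoint per level gives an infinite transient set. -/

namespace Enlargement

/-! ### Hitting probabilities, superharmonic functions and transience criteria -/

section Walk

variable {V : Type*} {G : SimpleGraph V}

/-- The expectation of `f` after one step of the simple random walk from `x`. -/
noncomputable def stepE (G : SimpleGraph V) (f : V → ℝ≥0∞) (x : V) : ℝ≥0∞ :=
  ∑' y, stepPMF G x y * f y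

lemma stepE_mono {f g : V → ℝ≥0∞} (h : ∀ y, f y ≤ g y) (x : V) : stepE G f x ≤ stepE G g x :=
  ENNReal.tsum_le_tsum fun y => by gcongr; exact h y

lemma stepE_const_mul (c : ℝ≥0∞) (f : V → ℝ≥0∞) (x : V) :
    stepE G (fun y => c * f y) x = c * stepE G f x := by
  simp only [stepE, ← ENNReal.tsum_mul_left]
  exact tsum_congr fun y => by ring

lemma stepE_one (x : V) : stepE G (fun _ => 1) x = 1 := by
  simp [stepE, (stepPMF G x).tsum_coe]

lemma lintegral_toMeasure [MeasurableSpace V] [DiscreteMeasurableSpace V] (p : PMF V)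
    (f : V → ℝ≥0∞) : ∫⁻ y, f y ∂p.toMeasure = ∑' y, p y * f y := by
  have : p.toMeasure = Measure.sum fun y => p y • Measure.dirac y := by
    ext s hs
    rw [Measure.sum_apply _ hs, p.toMeasure_apply hs]
    refine tsum_congr fun y => ?_
    by_cases hy : y ∈ s <;> simp [hy]
  rw [this, lintegral_sum_measure]
  refine tsum_congr fun y => ?_
  rw [lintegral_smul_measure, lintegral_dirac]
  rfl

lemma stepE_iSup {f : ℕ → V → ℝ≥0∞} (hf : Monotone f) (x : V) :
    stepE G (fun y => ⨆ k, f k y) x = ⨆ k, stepE G (f k) x := by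
  let _ : MeasurableSpace V := ⊤
  have : DiscreteMeasurableSpace V := ⟨fun _ => trivial⟩
  simp only [stepE, ← lintegral_toMeasure]
  exact lintegral_iSup (fun _ => Measurable.of_discrete) hf

/-- The one-step expectation is an average over the neighbours. -/
lemma stepE_eq_sum {x : V} {s : Finset V} (hs : s.Nonempty) (h : ∀ y, y ∈ s ↔ G.Adj x y)
    (f : V → ℝ≥0∞) : stepE G f x = (∑ y ∈ s, f y) / s.card := by
  classical
  have hN : G.neighborSet x = ↑s := by
    ext y; simp [h]
  have hex : ∃ hf : (G.neighborSet x).Finite, hf.toFinset.Nonempty := by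
    refine ⟨hN ▸ s.finite_toSet, ?_⟩
    obtain ⟨y, hy⟩ := hs
    exact ⟨y, by simpa using (h y).1 hy⟩
  have hfs : hex.choose.toFinset = s := by
    ext y; simp [h]
  have hp : ∀ y, stepPMF G x y = if y ∈ s then (s.card : ℝ≥0∞)⁻¹ else 0 := by
    intro y
    unfold stepPMF
    rw [dif_pos hex, PMF.uniformOfFinset_apply]
    simp only [hfs]
  rw [stepE, tsum_eq_sum (s := s) (fun y hy => by simp [hp, hy]), div_eq_mul_inv,
    Finset.sum_mul]
  exact Finset.sum_congr rfl fun y hy => by rw [hp, if_pos hy, mul_comm]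

/-- The probability that the walk from `x` visits `A` within `k` steps. -/
noncomputable def hitWithin (G : SimpleGraph V) (A : Set V) : ℕ → V → ℝ≥0∞
  | 0 => A.indicator 1
  | k + 1 => fun x => by
      classical
      exact if x ∈ A then 1 else stepE G (hitWithin G A k) x

/-- The probability that the walk from `x` ever visits `A`. -/
noncomputable def hit (G : SimpleGraph V) (A : Set V) (x : V) : ℝ≥0∞ :=
  ⨆ k, hitWithin G A k x

lemma hitWithin_of_mem {A : Set V} {x : V} (hx : x ∈ A) (k : ℕ) : hitWithin G A k x = 1 := by
  cases k <;> simp [hitWithin, hx]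

lemma hitWithin_succ_of_notMem {A : Set V} {x : V} (hx : x ∉ A) (k : ℕ) :
    hitWithin G A (k + 1) x = stepE G (hitWithin G A k) x := by
  simp [hitWithin, hx]

lemma hitWithin_le_one (A : Set V) (k : ℕ) (x : V) : hitWithin G A k x ≤ 1 := by
  induction k generalizing x with
  | zero => exact indicator_le_self' (by simp) x
  | succ k ih =>
    by_cases hx : x ∈ A
    · rw [hitWithin_of_mem hx]
    · rw [hitWithin_succ_of_notMem hx]
      exact (stepE_mono ih x).trans_eq (stepE_one x)

lemma hitWithin_mono (A : Set V) : Monotone (hitWithin G A) := by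
  refine monotone_nat_of_le_succ fun k => ?_
  induction k with
  | zero =>
    intro x
    by_cases hx : x ∈ A
    · simp [hitWithin_of_mem hx]
    · simp [hitWithin, hx]
  | succ k ih =>
    intro x
    by_cases hx : x ∈ A
    · simp [hitWithin_of_mem hx]
    · rw [hitWithin_succ_of_notMem hx, hitWithin_succ_of_notMem hx]
      exact stepE_mono ih x

lemma hit_le_one (A : Set V) (x : V) : hit G A x ≤ 1 := iSup_le fun k => hitWithin_le_one A k x

lemma hit_ne_top (A : Set V) (x : V) : hit G A x ≠ ∞ := ((hit_le_one A x).trans_lt (by simp)).ne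

lemma hit_of_mem {A : Set V} {x : V} (hx : x ∈ A) : hit G A x = 1 := by
  simp [hit, hitWithin_of_mem hx]

lemma hit_of_notMem {A : Set V} {x : V} (hx : x ∉ A) : hit G A x = stepE G (hit G A) x := by
  have h1 : hit G A x = ⨆ k, hitWithin G A (k + 1) x :=
    (Monotone.iSup_nat_add (f := fun k => hitWithin G A k x)
      (fun a b h => hitWithin_mono A h x) 1).symm
  have h2 : hit G A = fun y => ⨆ k, hitWithin G A k y := rfl
  rw [h1, h2, stepE_iSup (hitWithin_mono A)]
  simp only [hitWithin_succ_of_notMem hx]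

lemma stepE_hit_le (A : Set V) (x : V) : stepE G (hit G A) x ≤ hit G A x := by
  by_cases hx : x ∈ A
  · rw [hit_of_mem hx]
    exact (stepE_mono (hit_le_one A) x).trans_eq (stepE_one x)
  · exact (hit_of_notMem hx).ge

/-- `hit G X` is the smallest superharmonic function that is at least `1` on `X`. -/
lemma mul_hit_le {X : Set V} {u : V → ℝ≥0∞} {δ : ℝ≥0∞} (hu : ∀ x, stepE G u x ≤ u x)
    (hX : ∀ x ∈ X, δ ≤ u x) (x : V) : δ * hit G X x ≤ u x := by
  rw [hit, ENNReal.mul_iSup]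
  refine iSup_le fun k => ?_
  induction k generalizing x with
  | zero =>
    by_cases hx : x ∈ X
    · simpa [hitWithin_of_mem hx] using hX x hx
    · simp [hitWithin, hx]
  | succ k ih =>
    by_cases hx : x ∈ X
    · simpa [hitWithin_of_mem hx] using hX x hx
    · rw [hitWithin_succ_of_notMem hx, ← stepE_const_mul]
      exact (stepE_mono ih x).trans (hu x)

section Law

variable [MeasurableSpace V] [DiscreteMeasurableSpace V]

instance (x : V) : IsProbabilityMeasure (srwLaw G x) := by
  unfold srwLaw; infer_instance

lemma map_traj_step (n : ℕ) (y : (i : Finset.Iic n) → V) :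
    (Kernel.traj (X := fun _ => V) (stepKernel G) n y).map (fun S => S (n + 1)) =
      (stepPMF G (y ⟨n, Finset.mem_Iic.2 le_rfl⟩)).toMeasure := by
  have h : (Kernel.traj (X := fun _ => V) (stepKernel G) n).map (fun S => S (n + 1)) y =
      stepKernel G n y := by
    rw [Kernel.map_traj_succ_self]
  rwa [Kernel.map_apply _ (measurable_pi_apply _)] at h

lemma lintegral_traj_step (n : ℕ) (y : (i : Finset.Iic n) → V) (φ : V → ℝ≥0∞) :
    ∫⁻ S : ℕ → V, φ (S (n + 1)) ∂(Kernel.traj (X := fun _ => V) (stepKernel G) n y) =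
      stepE G φ (y ⟨n, Finset.mem_Iic.2 le_rfl⟩) := by
  rw [stepE, ← lintegral_toMeasure, ← map_traj_step,
    lintegral_map .of_discrete (measurable_pi_apply _)]

/-- The Markov property at time `n`. -/
lemma lintegral_markov (x : V) (n : ℕ) {f : ((i : Finset.Iic n) → V) → ℝ≥0∞} (hf : Measurable f)
    (φ : V → ℝ≥0∞) :
    ∫⁻ S, f (Preorder.frestrictLe n S) * φ (S (n + 1)) ∂srwLaw G x =
      ∫⁻ S, f (Preorder.frestrictLe n S) * stepE G φ (S n) ∂srwLaw G x := by
  have hφ : Measurable φ := .of_discrete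
  have hψ : Measurable (stepE G φ) := .of_discrete
  have key := Kernel.partialTraj_compProd_traj (X := fun _ => V) (κ := stepKernel G)
    (Nat.zero_le n) (fun _ => x)
  have h1 : ∫⁻ S, f (Preorder.frestrictLe n S) * φ (S (n + 1)) ∂srwLaw G x =
      ∫⁻ q, f q.1 * φ (q.2 (n + 1)) ∂((srwLaw G x).map
        (fun S => (Preorder.frestrictLe (π := fun _ => V) n S, S))) := by
    rw [lintegral_map (by fun_prop) (by fun_prop)]
  have h2 : ∫⁻ S, f (Preorder.frestrictLe n S) * stepE G φ (S n) ∂srwLaw G x =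
      ∫⁻ y, f y * stepE G φ (y ⟨n, Finset.mem_Iic.2 le_rfl⟩)
        ∂((srwLaw G x).map (Preorder.frestrictLe (π := fun _ => V) n)) := by
    rw [lintegral_map (by fun_prop) (by fun_prop)]
    rfl
  have h3 : (srwLaw G x).map (Preorder.frestrictLe (π := fun _ => V) n) =
      Kernel.partialTraj (X := fun _ => V) (stepKernel G) 0 n (fun _ => x) :=
    Kernel.traj_map_frestrictLe_apply 0 n _
  rw [h1, h2, h3]
  unfold srwLaw
  rw [← key, Measure.lintegral_compProd (by fun_prop)]
  refine lintegral_congr fun y => ?_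
  change ∫⁻ S : ℕ → V, f y * φ (S (n + 1)) ∂_ = _
  have hm : Measurable fun S : ℕ → V => φ (S (n + 1)) := hφ.comp (measurable_pi_apply _)
  rw [lintegral_const_mul _ hm, lintegral_traj_step]

lemma lintegral_succ (x : V) (n : ℕ) (φ : V → ℝ≥0∞) :
    ∫⁻ S, φ (S (n + 1)) ∂srwLaw G x = ∫⁻ S, stepE G φ (S n) ∂srwLaw G x := by
  simpa using lintegral_markov (G := G) x n (f := fun _ => 1) measurable_const φ

lemma lintegral_zero (x : V) (φ : V → ℝ≥0∞) : ∫⁻ S, φ (S 0) ∂srwLaw G x = φ x := by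
  have h3 : (srwLaw G x).map (Preorder.frestrictLe (π := fun _ => V) 0) =
      Kernel.partialTraj (X := fun _ => V) (stepKernel G) 0 0 (fun _ => x) :=
    Kernel.traj_map_frestrictLe_apply 0 0 _
  have hφ : Measurable φ := .of_discrete
  have : ∫⁻ S, φ (S 0) ∂srwLaw G x = ∫⁻ y, φ (y ⟨0, Finset.mem_Iic.2 le_rfl⟩)
        ∂((srwLaw G x).map (Preorder.frestrictLe (π := fun _ => V) 0)) := by
    rw [lintegral_map (by fun_prop) (by fun_prop)]
    rfl
  rw [this, h3, Kernel.partialTraj_self, Kernel.id_apply, lintegral_dirac' _ (by fun_prop)]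

/-- The event that the walk visits `A` at some time in `[n, n + k]`. -/
lemma measure_visit (A : Set V) (x : V) (n k : ℕ) :
    srwLaw G x {S | ∃ j ≤ k, S (n + j) ∈ A} = ∫⁻ S, hitWithin G A k (S n) ∂srwLaw G x := by
  classical
  -- Interpolation between the two sides: the first `m` positions are read off the path and the last
  -- `k` steps are summarised by `hitWithin`. The Markov property trades one unit of `k` for one of
  -- `m`.
  have key : ∀ m k, ∫⁻ S, (if ∃ j < m, S (n + j) ∈ A then 1 else hitWithin G A k (S (n + m)))
      ∂srwLaw G x = srwLaw G x {S | ∃ j ≤ m + k, S (n + j) ∈ A} := by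
    intro m k
    induction k generalizing m with
    | zero =>
      rw [← lintegral_indicator_one]
      · refine lintegral_congr fun S => ?_
        have : (∃ j ≤ m, S (n + j) ∈ A) ↔ (∃ j < m, S (n + j) ∈ A) ∨ S (n + m) ∈ A := by
          simp only [Nat.le_iff_lt_or_eq, or_and_right, exists_or, exists_eq_left]
        simp only [hitWithin, indicator_apply, mem_ofPred_eq, add_zero, this, Pi.one_apply]
        by_cases h1 : ∃ j < m, S (n + j) ∈ A
        · simp only [h1, true_or, if_true]
        · simp only [h1, false_or, if_false]
      · have : {S : ℕ → V | ∃ j ≤ m + 0, S (n + j) ∈ A} =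
            ⋃ j ≤ m + 0, (fun S : ℕ → V => S (n + j)) ⁻¹' A := by ext; simp
        rw [this]
        exact .biUnion (to_countable _) fun j _ => measurable_pi_apply _ .of_discrete
    | succ k ih =>
      rw [show m + (k + 1) = m + 1 + k by ring, ← ih (m + 1)]
      have e1 : ∀ S : ℕ → V,
          (if ∃ j < m, S (n + j) ∈ A then 1 else hitWithin G A (k + 1) (S (n + m))) =
          (if ∃ j < m + 1, S (n + j) ∈ A then 1 else 0) +
          (if ∃ j < m + 1, S (n + j) ∈ A then 0 else 1) *
            stepE G (hitWithin G A k) (S (n + m)) := by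
        intro S
        have : (∃ j < m + 1, S (n + j) ∈ A) ↔ (∃ j < m, S (n + j) ∈ A) ∨ S (n + m) ∈ A := by
          simp only [Nat.lt_succ_iff_lt_or_eq, or_and_right, exists_or, exists_eq_left]
        by_cases h1 : ∃ j < m, S (n + j) ∈ A
        · simp only [this, h1, true_or, if_true]; simp
        · by_cases h2 : S (n + m) ∈ A
          · simp only [this, h1, h2, hitWithin_of_mem]; simp
          · simp only [this, h1, h2, hitWithin_succ_of_notMem, not_false_eq_true]; simp
      have e2 : ∀ S : ℕ → V,
          (if ∃ j < m + 1, S (n + j) ∈ A then 1 else hitWithin G A k (S (n + (m + 1)))) =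
          (if ∃ j < m + 1, S (n + j) ∈ A then 1 else 0) +
          (if ∃ j < m + 1, S (n + j) ∈ A then 0 else 1) *
            hitWithin G A k (S (n + m + 1)) := by
        intro S
        by_cases h1 : ∃ j < m + 1, S (n + j) ∈ A
        · simp only [h1]; simp
        · simp only [h1]; simp [add_assoc]
      have hmeas : MeasurableSet {S : ℕ → V | ∃ j < m + 1, S (n + j) ∈ A} := by
        have : {S : ℕ → V | ∃ j < m + 1, S (n + j) ∈ A} =
            ⋃ j < m + 1, (fun S : ℕ → V => S (n + j)) ⁻¹' A := by ext; simp
        rw [this]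
        exact .biUnion (to_countable _) fun j _ => measurable_pi_apply _ .of_discrete
      have hm1 : Measurable fun S : ℕ → V =>
          (if ∃ j < m + 1, S (n + j) ∈ A then (1 : ℝ≥0∞) else 0) :=
        Measurable.ite hmeas measurable_const measurable_const
      simp only [e1, e2]
      rw [lintegral_add_left hm1, lintegral_add_left hm1]
      congr 1
      have hP : ∀ S : ℕ → V, (∃ j < m + 1, S (n + j) ∈ A) ↔
          ∃ j, ∃ h : j ≤ m, Preorder.frestrictLe (π := fun _ => V) (n + m) S
            ⟨n + j, Finset.mem_Iic.2 (by omega)⟩ ∈ A := by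
        intro S
        simp
      simp only [hP]
      refine (lintegral_markov x (n + m) (f := fun y =>
        if ∃ j, ∃ h : j ≤ m, y ⟨n + j, Finset.mem_Iic.2 (by omega)⟩ ∈ A then 0 else 1)
        ?_ _).symm
      refine Measurable.ite ?_ measurable_const measurable_const
      have : {y : (i : Finset.Iic (n + m)) → V |
          ∃ j, ∃ h : j ≤ m, y ⟨n + j, Finset.mem_Iic.2 (by omega)⟩ ∈ A} =
          ⋃ j, ⋃ h : j ≤ m, (fun y => y ⟨n + j, Finset.mem_Iic.2 (by omega)⟩) ⁻¹' A := by
        ext; simp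
      rw [this]
      exact .iUnion fun j => .iUnion fun h => measurable_pi_apply _ .of_discrete
  have := key 0 k
  simp only [not_lt_zero, false_and, exists_false, if_false, add_zero, zero_add] at this
  exact this.symm

lemma measure_visit_after (A : Set V) (x : V) (n : ℕ) :
    srwLaw G x {S | ∃ m ≥ n, S m ∈ A} = ∫⁻ S, hit G A (S n) ∂srwLaw G x := by
  have h1 : {S : ℕ → V | ∃ m ≥ n, S m ∈ A} = ⋃ k, {S | ∃ j ≤ k, S (n + j) ∈ A} := by
    ext S
    simp only [mem_ofPred_eq, mem_iUnion]
    constructor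
    · rintro ⟨m, hm, h⟩
      exact ⟨m - n, m - n, le_rfl, by rwa [Nat.add_sub_cancel' hm]⟩
    · rintro ⟨k, j, -, h⟩
      exact ⟨n + j, by omega, h⟩
  rw [h1, Monotone.measure_iUnion]
  · simp only [measure_visit, hit]
    rw [lintegral_iSup]
    · exact fun k => (Measurable.of_discrete (f := hitWithin G A k)).comp (measurable_pi_apply n)
    · exact fun a b h S => hitWithin_mono A h (S n)
  · rintro a b h S ⟨j, hj, hS⟩
    exact ⟨j, hj.trans h, hS⟩

/-- Visiting infinitely often is the decreasing intersection of the events of a visit after time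
`n`. This turns bounds on `hit` into recurrence or transience. -/
lemma measure_frequently (A : Set V) (x : V) :
    srwLaw G x {S | ∃ᶠ n in atTop, S n ∈ A} = ⨅ n, ∫⁻ S, hit G A (S n) ∂srwLaw G x := by
  have h1 : {S : ℕ → V | ∃ᶠ n in atTop, S n ∈ A} = ⋂ n, {S | ∃ m ≥ n, S m ∈ A} := by
    ext S
    simp [frequently_atTop]
  have hmeas : ∀ n, MeasurableSet {S : ℕ → V | ∃ m ≥ n, S m ∈ A} := by
    intro n
    have : {S : ℕ → V | ∃ m ≥ n, S m ∈ A} = ⋃ m ≥ n, (fun S : ℕ → V => S m) ⁻¹' A := by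
      ext; simp
    rw [this]
    exact .biUnion (to_countable _) fun j _ => measurable_pi_apply _ .of_discrete
  rw [h1, Antitone.measure_iInter]
  · simp only [measure_visit_after]
  · rintro a b h S ⟨m, hm, hS⟩
    exact ⟨m, h.trans hm, hS⟩
  · exact fun n => (hmeas n).nullMeasurableSet
  · exact ⟨0, measure_ne_top _ _⟩

end Law

lemma isTransientSubset_iff (A : Set V) :
    IsTransientSubset G A ↔ ∀ x, ioProb G x A = 0 := by
  simp [IsTransientSubset, IsRecurrentSubset]

/-- A set of points from which a transient set is reached with probability bounded below is
transient. -/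
lemma IsTransientSubset.of_le_hit {A X : Set V} (hA : IsTransientSubset G A) {δ : ℝ≥0∞}
    (hδ : δ ≠ 0) (hX : ∀ x ∈ X, δ ≤ hit G A x) : IsTransientSubset G X := by
  let _ : MeasurableSpace V := ⊤
  have : DiscreteMeasurableSpace V := ⟨fun _ => trivial⟩
  rw [isTransientSubset_iff] at hA ⊢
  intro x
  have h := hA x
  unfold ioProb at h ⊢
  rw [measure_frequently] at h ⊢
  -- `hit G A` is superharmonic and at least `δ` on `X`, so minimality gives `δ * hit G X ≤ hit G
  -- A`; this is integrated along the walk.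
  have h2 : δ * ⨅ n, ∫⁻ S, hit G X (S n) ∂srwLaw G x ≤ ⨅ n, ∫⁻ S, hit G A (S n) ∂srwLaw G x := by
    refine le_iInf fun n => ?_
    calc δ * ⨅ n, ∫⁻ S, hit G X (S n) ∂srwLaw G x
        ≤ δ * ∫⁻ S, hit G X (S n) ∂srwLaw G x := by gcongr; exact iInf_le _ n
      _ = ∫⁻ S, δ * hit G X (S n) ∂srwLaw G x :=
          (lintegral_const_mul _ ((Measurable.of_discrete (f := hit G X)).comp
            (measurable_pi_apply n))).symm
      _ ≤ _ := lintegral_mono fun S => mul_hit_le (stepE_hit_le A) hX (S n)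
  rw [h, nonpos_iff_eq_zero, mul_eq_zero] at h2
  exact h2.resolve_left hδ

lemma IsTransientSubset.mono {A B : Set V} (hB : IsTransientSubset G B) (h : A ⊆ B) :
    IsTransientSubset G A :=
  hB.of_le_hit one_ne_zero fun _ hx => (hit_of_mem (h hx)).ge

lemma IsTransientSubset.union {A B : Set V} (hA : IsTransientSubset G A)
    (hB : IsTransientSubset G B) : IsTransientSubset G (A ∪ B) := by
  let _ : MeasurableSpace V := ⊤
  have : DiscreteMeasurableSpace V := ⟨fun _ => trivial⟩
  rw [isTransientSubset_iff] at *
  intro x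
  have h1 := hA x
  have h2 := hB x
  unfold ioProb at *
  refine measure_mono_null ?_ (measure_union_null h1 h2)
  intro S hS
  exact frequently_or_distrib.1 hS

lemma isTransientSubset_of_finite (hconn : G.Connected)
    {A : Set V} (hA : A.Finite) (hs : ∀ a, IsTransientSubset G {a}) : IsTransientSubset G A := by
  induction A, hA using Set.Finite.induction_on with
  | empty => exact (hs (hconn.nonempty.some)).mono (by simp)
  | insert _ _ ih => rw [insert_eq]; exact (hs _).union ih

/-- A set is transient if there is a finite nonnegative function whose mean decreases by a
definite amount under a step from a point of the set. -/
lemma isTransientSubset_of_potential {A : Set V} (g : V → ℝ≥0∞) (hg : ∀ x, g x ≠ ∞) {c : ℝ≥0∞}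
    (hc : c ≠ 0) (h : ∀ x, stepE G g x + A.indicator (fun _ => c) x ≤ g x) :
    IsTransientSubset G A := by
  let _ : MeasurableSpace V := ⊤
  have : DiscreteMeasurableSpace V := ⟨fun _ => trivial⟩
  rw [isTransientSubset_iff]
  intro x
  unfold ioProb
  set μ := srwLaw G x
  have hm : ∀ (f : V → ℝ≥0∞) n, Measurable fun S : ℕ → V => f (S n) := fun f n =>
    (Measurable.of_discrete (f := f)).comp (measurable_pi_apply n)
  have step : ∀ n, ∫⁻ S, g (S (n + 1)) ∂μ + c * μ {S | S n ∈ A} ≤ ∫⁻ S, g (S n) ∂μ := by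
    intro n
    have hA : MeasurableSet ((fun S : ℕ → V => S n) ⁻¹' A) := measurable_pi_apply n .of_discrete
    change _ + c * μ ((fun S : ℕ → V => S n) ⁻¹' A) ≤ _
    rw [lintegral_succ, ← lintegral_indicator_const hA, ← lintegral_add_left (hm _ n)]
    exact lintegral_mono fun S => h (S n)
  -- Telescoping bounds `c` times the expected number of visits to `A` by `g x < ∞`; the first
  -- Borel–Cantelli lemma then applies.
  have sum : ∀ n, ∫⁻ S, g (S n) ∂μ + c * ∑ i ∈ Finset.range n, μ {S | S i ∈ A} ≤ g x := by
    intro n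
    induction n with
    | zero => simpa using (lintegral_zero (G := G) x g).le
    | succ n ih =>
      rw [Finset.sum_range_succ]
      refine le_trans ?_ ih
      calc _ = (∫⁻ S, g (S (n + 1)) ∂μ + c * μ {S | S n ∈ A})
            + c * ∑ i ∈ Finset.range n, μ {S | S i ∈ A} := by ring
        _ ≤ _ := by gcongr; exact step n
  have htot : c * ∑' i, μ {S | S i ∈ A} ≤ g x := by
    rw [ENNReal.tsum_eq_iSup_nat, ENNReal.mul_iSup]
    exact iSup_le fun n => le_trans le_add_self (sum n)
  refine measure_setOfPred_frequently_eq_zero fun h => ?_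
  rw [h, ENNReal.mul_top hc] at htot
  exact hg x (top_le_iff.1 htot)

/-- A set that is hit almost surely from every point is recurrent. -/
lemma isRecurrentSubset_of_hit_eq_one [Nonempty V] {A : Set V} (h : ∀ x, hit G A x = 1) :
    IsRecurrentSubset G A := by
  let _ : MeasurableSpace V := ⊤
  have : DiscreteMeasurableSpace V := ⟨fun _ => trivial⟩
  refine ⟨Classical.arbitrary V, ?_⟩
  unfold ioProb
  rw [measure_frequently]
  simp [h]

lemma hit_pos_of_reachable (hfin : ∀ v : V, (G.neighborSet v).Finite) {o v : V}
    (h : G.Reachable v o) : hit G {o} v ≠ 0 := by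
  classical
  obtain ⟨w⟩ := h
  induction w with
  | nil => simp [hit_of_mem]
  | @cons a b c hab _ ih =>
    have hs : ∀ y, y ∈ (hfin a).toFinset ↔ G.Adj a y := by simp
    have hn : (hfin a).toFinset.Nonempty := ⟨b, by simpa using hab⟩
    intro h0
    have h1 := stepE_hit_le (G := G) {c} a
    rw [h0, stepE_eq_sum hn hs, nonpos_iff_eq_zero, ENNReal.div_eq_zero_iff,
      Finset.sum_eq_zero_iff] at h1
    rcases h1 with h1 | h1
    · exact ih (h1 b (by simpa using hab))
    · exact ENNReal.natCast_ne_top _ h1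

/-- By connectedness `o` is hit from `v` with positive probability, so checking one vertex is enough
for transience of the graph. -/
lemma IsTransientSubset.singleton (hfin : ∀ v : V, (G.neighborSet v).Finite) (hconn : G.Connected)
    {o : V} (ho : IsTransientSubset G {o}) (v : V) : IsTransientSubset G {v} :=
  ho.of_le_hit (hit_pos_of_reachable hfin (hconn v o)) fun _ hx => by rw [mem_singleton_iff.1 hx]

lemma isTransientGraph_of_singleton (hfin : ∀ v : V, (G.neighborSet v).Finite)
    (hconn : G.Connected) {o : V} (ho : IsTransientSubset G {o}) : IsTransientGraph G :=
  fun v => (isTransientSubset_iff _).1 (ho.singleton hfin hconn v) v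

end Walk

/-! ### The line of cut points with a subdivided tree -/

lemma stepE_ofReal {V ι : Type*} {G : SimpleGraph V} [Fintype ι] [Nonempty ι] {x : V}
    (e : ι → V) (he : e.Injective) (h : ∀ y, G.Adj x y ↔ ∃ i, e i = y) {f : V → ℝ}
    (hf : ∀ y, 0 ≤ f y) :
    stepE G (fun y => ENNReal.ofReal (f y)) x =
      ENNReal.ofReal ((∑ i, f (e i)) / Fintype.card ι) := by
  classical
  rw [stepE_eq_sum (s := Finset.univ.image e) (by simp) (by simp [h]),
    Finset.sum_image (fun a _ b _ hab => he hab), Finset.card_image_of_injective _ he,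
    Finset.card_univ, ENNReal.ofReal_div_of_pos (by simp [Fintype.card_pos]),
    ENNReal.ofReal_sum_of_nonneg fun i _ => hf _, ENNReal.ofReal_natCast]

/-- The vertices of a line of cut points `cut 0, cut 1, …`, consecutive ones joined by `N n` paths
of length two, with a regular tree attached to `cut 0` whose edges at depth `k` are subdivided into
`L k + 1` edges. The children of a vertex of the tree are indexed by `B`. -/
inductive Vtx (N L : ℕ → ℕ) (B : Type) : Type
  | cut (n : ℕ) : Vtx N L B
  | mid (n : ℕ) (i : Fin (N n)) : Vtx N L B
  | node (b : B) (w : List B) (i : Fin (L w.length + 1)) : Vtx N L B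

namespace Vtx

variable {N L : ℕ → ℕ} {B : Type}

/-- The branching point with address `w`. -/
def base : List B → Vtx N L B
  | [] => cut 0
  | b :: w => node b w (Fin.last _)

/-- The `j`-th vertex on the chain from `base w` to `base (b :: w)`. -/
def chainPt (b : B) (w : List B) : ℕ → Vtx N L B
  | 0 => base w
  -- `Fin.ofNat` wraps around, so only indices up to `L w.length + 1` are meaningful; the last one
  -- is the next branching point.
  | j + 1 => node b w (Fin.ofNat _ j)

/-- The edges of the graph, directed towards the earlier end of a chain. -/
inductive Edge : Vtx N L B → Vtx N L B → Prop
  | lo (n : ℕ) (i : Fin (N n)) : Edge (mid n i) (cut n)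
  | hi (n : ℕ) (i : Fin (N n)) : Edge (mid n i) (cut (n + 1))
  | chain (b : B) (w : List B) (i : Fin (L w.length + 1)) : Edge (node b w i) (chainPt b w i)

lemma chainPt_succ (b : B) (w : List B) (i : Fin (L w.length + 1)) :
    chainPt b w (i + 1) = (node b w i : Vtx N L B) := by
  simp [chainPt]

lemma chainPt_last (b : B) (w : List B) :
    chainPt b w (L w.length + 1) = (base (b :: w) : Vtx N L B) := by
  rw [base, ← chainPt_succ]; rfl

lemma base_injective : (base : List B → Vtx N L B).Injective := by
  intro v w h
  cases v <;> cases w <;> simp_all [base]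

/-- The bound on `j` leaves out the far end of the chain, which is itself the branching point `base
(b :: w)`. -/
lemma chainPt_eq_base_iff {b : B} {w v : List B} {j : ℕ} (hj : j ≤ L w.length) :
    (chainPt b w j : Vtx N L B) = base v ↔ j = 0 ∧ w = v := by
  cases j with
  | zero => simp [chainPt, base_injective.eq_iff]
  | succ j =>
    simp only [chainPt, Nat.add_eq_zero_iff, one_ne_zero, and_false, false_and, iff_false]
    cases v with
    | nil => simp [base]
    | cons c v =>
      simp only [base, node.injEq, not_and]
      rintro rfl rfl h
      have := congrArg Fin.val (eq_of_heq h)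
      simp [Nat.mod_eq_of_lt (show j < L w.length + 1 by omega)] at this
      omega

lemma chainPt_eq_node_iff {b c : B} {w v : List B} {j : ℕ} (hj : j ≤ L w.length)
    {i : Fin (L v.length + 1)} (hi : i.val < L v.length) :
    (chainPt b w j : Vtx N L B) = node c v i ↔ b = c ∧ w = v ∧ j = i + 1 := by
  cases j with
  | zero =>
    cases w with
    | nil => simp [chainPt, base]
    | cons d w =>
      simp only [chainPt, base, node.injEq]
      constructor
      · rintro ⟨rfl, rfl, h⟩
        have := congrArg Fin.val (eq_of_heq h)
        simp at this
        omega
      · simp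
  | succ j =>
    simp only [chainPt, node.injEq]
    constructor
    · rintro ⟨rfl, rfl, h⟩
      have := congrArg Fin.val (eq_of_heq h)
      simp [Nat.mod_eq_of_lt (show j < L w.length + 1 by omega)] at this
      simp [this]
    · rintro ⟨rfl, rfl, h⟩
      refine ⟨rfl, rfl, heq_of_eq ?_⟩
      ext
      simp [Nat.mod_eq_of_lt (show j < L w.length + 1 by omega)]
      omega

lemma Edge.ne {x y : Vtx N L B} (h : Edge x y) : x ≠ y := by
  cases h with
  | lo n i => simp
  | hi n i => simp
  | chain b w i =>
    intro hy
    by_cases hi : i.val < L w.length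
    · have := (chainPt_eq_node_iff (N := N) (b := b) (c := b) (w := w) (by omega) hi).1 hy.symm
      omega
    · have h2 : i.val = L w.length := by omega
      rw [← chainPt_succ, h2, chainPt_last] at hy
      have := (chainPt_eq_base_iff (N := N) (b := b) (w := w) (v := b :: w) (by omega)).1 hy.symm
      simp at this

end Vtx

open Vtx

variable {N L : ℕ → ℕ} {B : Type}

/-- The line of cut points with a subdivided tree attached. -/
def lineTree (N L : ℕ → ℕ) (B : Type) : SimpleGraph (Vtx N L B) where
  Adj x y := Edge x y ∨ Edge y x
  symm := ⟨fun _ _ h => h.symm⟩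
  loopless := ⟨fun _ h => h.elim (fun h => h.ne rfl) fun h => h.ne rfl⟩

namespace Vtx

lemma edge_cut_iff {x : Vtx N L B} {n : ℕ} : Edge x (cut n) ↔
    (∃ i, x = mid n i) ∨ (∃ m i, n = m + 1 ∧ x = mid m i) ∨ (n = 0 ∧ ∃ b, x = node b [] 0) := by
  constructor
  · intro h
    generalize hy : cut n = y at h
    cases h with
    | lo m i => cases hy; exact .inl ⟨i, rfl⟩
    | hi m i => cases hy; exact .inr (.inl ⟨m, i, rfl, rfl⟩)
    | chain b w i =>
      cases n with
      | zero =>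
        obtain ⟨h1, rfl⟩ := (chainPt_eq_base_iff (v := []) (by omega)).1 hy.symm
        refine .inr (.inr ⟨rfl, b, ?_⟩)
        congr
        exact Fin.ext h1
      | succ n =>
        exfalso
        obtain ⟨i, hi⟩ := i
        cases i with
        | zero => cases w <;> simp [chainPt, base] at hy
        | succ i => simp [chainPt] at hy
  · rintro (⟨i, rfl⟩ | ⟨m, i, rfl, rfl⟩ | ⟨rfl, b, rfl⟩)
    · exact .lo n i
    · exact .hi m i
    · exact .chain b [] 0

lemma edge_node_iff {x : Vtx N L B} {b : B} {w : List B} {i : Fin (L w.length + 1)}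
    (hi : i.val < L w.length) : Edge x (node b w i) ↔ x = chainPt b w (i + 2) := by
  have e : (chainPt b w (i + 2) : Vtx N L B) = node b w ⟨i + 1, by omega⟩ :=
    chainPt_succ b w ⟨i + 1, by omega⟩
  constructor
  · intro h
    generalize hy : node b w i = y at h
    cases h with
    | lo m i => simp at hy
    | hi m i => simp at hy
    | chain c v k =>
      obtain ⟨rfl, rfl, h⟩ := (chainPt_eq_node_iff (Nat.lt_succ_iff.1 k.2) hi).1 hy.symm
      rw [e]
      congr
      exact Fin.ext h
  · rintro rfl
    rw [e]
    have := Edge.chain (N := N) (L := L) b w ⟨i + 1, by omega⟩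
    rwa [chainPt_succ] at this

lemma edge_base_cons_iff {x : Vtx N L B} {b : B} {w : List B} :
    Edge x (node b w (Fin.last _)) ↔ ∃ c, x = node c (b :: w) 0 := by
  constructor
  · intro h
    generalize hy : node b w (Fin.last _) = y at h
    cases h with
    | lo m i => simp at hy
    | hi m i => simp at hy
    | chain c v k =>
      obtain ⟨h, rfl⟩ := (chainPt_eq_base_iff (v := b :: w) (by omega)).1 hy.symm
      exact ⟨c, by congr; exact Fin.ext h⟩
  · rintro ⟨c, rfl⟩
    exact .chain c (b :: w) 0

lemma edge_mid_left_iff {y : Vtx N L B} {n : ℕ} {i : Fin (N n)} :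
    Edge (mid n i) y ↔ y = cut n ∨ y = cut (n + 1) := by
  constructor
  · intro h
    generalize hx : mid n i = x at h
    cases h with
    | lo m k => cases hx; simp
    | hi m k => cases hx; simp
    | chain c v k => simp at hx
  · rintro (rfl | rfl)
    exacts [.lo n i, .hi n i]

lemma edge_node_left_iff {y : Vtx N L B} {b : B} {w : List B} {i : Fin (L w.length + 1)} :
    Edge (node b w i) y ↔ y = chainPt b w i := by
  constructor
  · intro h
    generalize hx : node b w i = x at h
    cases h with
    | lo m k => simp at hx
    | hi m k => simp at hx
    | chain c v k =>
      obtain ⟨rfl, rfl, h⟩ := node.inj hx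
      obtain rfl := eq_of_heq h
      rfl
  · rintro rfl
    exact .chain b w i

lemma not_edge_cut_left {y : Vtx N L B} {n : ℕ} : ¬ Edge (cut n) y := by
  intro h; cases h

lemma not_edge_mid {x : Vtx N L B} {n : ℕ} {i : Fin (N n)} : ¬ Edge x (mid n i) := by
  intro h
  generalize hy : mid n i = y at h
  cases h with
  | lo m k => simp at hy
  | hi m k => simp at hy
  | chain c v k =>
    obtain ⟨k, hk⟩ := k
    cases k with
    | zero => cases v <;> simp [chainPt, base] at hy
    | succ i => simp [chainPt] at hy

end Vtx

lemma lineTree_adj {x y : Vtx N L B} : (lineTree N L B).Adj x y ↔ Edge x y ∨ Edge y x := Iff.rfl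

/-- The average of `f` over the neighbours of a vertex. -/
noncomputable def avg [Fintype B] (f : Vtx N L B → ℝ) : Vtx N L B → ℝ
  | cut 0 => (∑ i, f (mid 0 i) + ∑ b, f (node b [] 0)) / (N 0 + Fintype.card B)
  | cut (n + 1) => (∑ i, f (mid (n + 1) i) + ∑ i, f (mid n i)) / (N (n + 1) + N n)
  | mid n _ => (f (cut n) + f (cut (n + 1))) / 2
  | node b w i =>
    if i.val < L w.length then (f (chainPt b w i) + f (chainPt b w (i + 2))) / 2
    else (f (chainPt b w i) + ∑ c, f (node c (b :: w) 0)) / (1 + Fintype.card B)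

lemma stepE_lineTree [Fintype B] (hN : ∀ n, 0 < N n) {f : Vtx N L B → ℝ} (hf : ∀ y, 0 ≤ f y)
    (x : Vtx N L B) :
    stepE (lineTree N L B) (fun y => ENNReal.ofReal (f y)) x = ENNReal.ofReal (avg f x) := by
  classical
  have hne : ∀ n, Nonempty (Fin (N n)) := fun n => ⟨⟨0, hN n⟩⟩
  match x with
  | cut 0 =>
    have := hne 0
    rw [stepE_ofReal (ι := Fin (N 0) ⊕ B) (Sum.elim (mid 0) fun b => node b [] 0) _ _ hf]
    · simp [avg, Fintype.sum_sum_type]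
    · rintro (i | b) (j | c) h <;> simp_all
    · intro y
      simp [lineTree_adj, not_edge_cut_left, edge_cut_iff, eq_comm]
  | cut (n + 1) =>
    have := hne n
    rw [stepE_ofReal (ι := Fin (N (n + 1)) ⊕ Fin (N n)) (Sum.elim (mid (n + 1)) (mid n)) _ _ hf]
    · simp [avg, Fintype.sum_sum_type]
    · rintro (i | b) (j | c) h <;> simp_all
    · intro y
      simp [lineTree_adj, not_edge_cut_left, edge_cut_iff, eq_comm]
  | mid n i =>
    rw [stepE_ofReal (ι := Bool) (fun b => bif b then cut n else cut (n + 1)) _ _ hf]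
    · simp [avg]
    · rintro (_ | _) (_ | _) h <;> simp_all
    · intro y
      simp [lineTree_adj, not_edge_mid, edge_mid_left_iff, eq_comm, or_comm]
  | node b w i =>
    by_cases hi : i.val < L w.length
    · rw [stepE_ofReal (ι := Bool) (fun c => bif c then chainPt b w i else chainPt b w (i + 2)) _ _
        hf]
      · simp [avg, hi]
      · have e : (chainPt b w (i + 2) : Vtx N L B) = node b w ⟨i + 1, by omega⟩ :=
          chainPt_succ b w ⟨i + 1, by omega⟩
        have h3 : (chainPt b w i : Vtx N L B) ≠ chainPt b w (i + 2) := by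
          by_cases h2 : i.val + 1 < L w.length
          · rw [e, Ne, chainPt_eq_node_iff (by omega) h2]
            simp only [true_and]
            omega
          · have : i.val + 2 = L w.length + 1 := by omega
            rw [this, chainPt_last, Ne, chainPt_eq_base_iff (by omega)]
            simp
        rintro (_ | _) (_ | _) h <;> simp_all
      · intro y
        simp [lineTree_adj, edge_node_left_iff, edge_node_iff hi, eq_comm, or_comm]
    · obtain rfl : i = Fin.last _ := Fin.ext (by simp; omega)
      rw [stepE_ofReal (ι := Option B) (fun c => c.elim (chainPt b w (L w.length))
        fun c => node c (b :: w) 0) _ _ hf]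
      · simp [avg, Fintype.sum_option, add_comm]
      -- The parent must differ from the children for the neighbours to be counted correctly. When
      -- `L w.length = 0` the parent is `base w`, and address lengths separate them.
      · have h3 : ∀ c, (chainPt b w (L w.length) : Vtx N L B) ≠ node c (b :: w) 0 := by
          intro c h
          cases hL : L w.length with
          | zero =>
            rw [hL] at h
            cases w with
            | nil => simp [chainPt, base] at h
            | cons d w =>
              simp [chainPt, base] at h
              have := congrArg List.length h.2.1
              simp at this
              omega
          | succ l =>
            rw [hL] at h
            simp [chainPt] at h
        rintro (_ | c) (_ | d) h
        · rfl
        · exact absurd h (h3 d)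
        · exact absurd h.symm (h3 c)
        · simpa using h
      · intro y
        simp [lineTree_adj, edge_node_left_iff, edge_base_cons_iff, eq_comm, Option.exists]

lemma lineTree_neighborSet_finite [Finite B] (x : Vtx N L B) :
    ((lineTree N L B).neighborSet x).Finite := by
  have h1 : {y : Vtx N L B | Edge x y}.Finite := by
    cases x with
    | cut n => simp [not_edge_cut_left]
    | mid n i =>
      refine (Set.toFinite {cut n, cut (n + 1)}).subset fun y hy => ?_
      simpa using edge_mid_left_iff.1 hy
    | node b w i =>
      refine (Set.toFinite {chainPt b w i}).subset fun y hy => ?_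
      simpa using edge_node_left_iff.1 hy
  have h2 : {y : Vtx N L B | Edge y x}.Finite := by
    cases x with
    | cut n =>
      refine ((Set.finite_range (mid n)).union ((Set.finite_range (mid (n - 1))).union
        (Set.finite_range fun b => node b [] 0))).subset fun y hy => ?_
      rcases edge_cut_iff.1 hy with ⟨i, rfl⟩ | ⟨m, i, rfl, rfl⟩ | ⟨rfl, b, rfl⟩
      · exact .inl ⟨i, rfl⟩
      · exact .inr (.inl ⟨i, rfl⟩)
      · exact .inr (.inr ⟨b, rfl⟩)
    | mid n i => simp [not_edge_mid]
    | node b w i =>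
      by_cases hi : i.val < L w.length
      · simp [edge_node_iff hi]
      · obtain rfl : i = Fin.last _ := Fin.ext (by simp; omega)
        refine (Set.finite_range fun c => node c (b :: w) 0).subset fun y hy => ?_
        obtain ⟨c, rfl⟩ := edge_base_cons_iff.1 hy
        exact ⟨c, rfl⟩
  exact (h1.union h2).subset fun y hy => hy

lemma lineTree_adj_chainPt (b : B) (w : List B) {j : ℕ} (hj : j ≤ L w.length) :
    (lineTree N L B).Adj (chainPt b w j) (chainPt b w (j + 1)) := by
  have := Edge.chain (N := N) (L := L) b w ⟨j, by omega⟩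
  rw [← chainPt_succ] at this
  exact .inr this

lemma lineTree_connected (hN : ∀ n, 0 < N n) : (lineTree N L B).Connected := by
  have hcut : ∀ n, (lineTree N L B).Reachable (cut 0) (cut n) := by
    intro n
    induction n with
    | zero => rfl
    | succ n ih =>
      have h1 : (lineTree N L B).Adj (cut n) (mid n ⟨0, hN n⟩) := .inr (.lo n _)
      have h2 : (lineTree N L B).Adj (mid n ⟨0, hN n⟩) (cut (n + 1)) := .inl (.hi n _)
      exact ih.trans (h1.reachable.trans h2.reachable)
  have hchain : ∀ b w j, j ≤ L w.length + 1 →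
      (lineTree N L B).Reachable (base w) (chainPt b w j) := by
    intro b w j
    induction j with
    | zero => intro _; rfl
    | succ j ih =>
      exact fun h => (ih (by omega)).trans (lineTree_adj_chainPt b w (by omega)).reachable
  have hbase : ∀ w, (lineTree N L B).Reachable (cut 0) (base w) := by
    intro w
    induction w with
    | nil => rfl
    | cons b w ih =>
      rw [← chainPt_last]
      exact ih.trans (hchain b w _ le_rfl)
  have hall : ∀ x, (lineTree N L B).Reachable (cut 0) x := by
    intro x
    cases x with
    | cut n => exact hcut n
    | mid n i =>
      have h1 : (lineTree N L B).Adj (cut n) (mid n i) := .inr (.lo n _)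
      exact (hcut n).trans h1.reachable
    | node b w i =>
      rw [← chainPt_succ]
      exact (hbase w).trans (hchain b w _ (by omega))
  have : Nonempty (Vtx N L B) := ⟨cut 0⟩
  exact ⟨fun x y => (hall x).symm.trans (hall y)⟩

instance : Infinite (Vtx N L B) := Infinite.of_injective cut fun _ _ h => by simpa using h

lemma isAdmissible_lineTree [Finite B] (hN : ∀ n, 0 < N n)
    (h : IsTransientSubset (lineTree N L B) {cut 0}) : IsAdmissible (lineTree N L B) where
  infinite := inferInstance
  connected := lineTree_connected hN
  locallyFinite := lineTree_neighborSet_finite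
  transient := isTransientGraph_of_singleton lineTree_neighborSet_finite (lineTree_connected hN) h

/-- The hitting probability as a real number. -/
noncomputable def hitR {V : Type*} (G : SimpleGraph V) (A : Set V) (x : V) : ℝ := (hit G A x).toReal

section hitR

variable {V : Type*} {G : SimpleGraph V} {A : Set V} {x : V}

lemma hitR_nonneg : 0 ≤ hitR G A x := ENNReal.toReal_nonneg

lemma hitR_le_one : hitR G A x ≤ 1 := ENNReal.toReal_mono (by simp) (hit_le_one A x)

lemma ofReal_hitR : ENNReal.ofReal (hitR G A x) = hit G A x :=
  ENNReal.ofReal_toReal (hit_ne_top A x)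

lemma hitR_of_mem (hx : x ∈ A) : hitR G A x = 1 := by simp [hitR, hit_of_mem hx]

end hitR

/-! ### Real-valued superharmonic functions and flows -/

section Average

variable [Fintype B]

lemma avg_nonneg {f : Vtx N L B → ℝ} (hf : ∀ y, 0 ≤ f y) (x : Vtx N L B) : 0 ≤ avg f x := by
  have : ∀ {ι : Type} [Fintype ι] (e : ι → Vtx N L B), 0 ≤ ∑ i, f (e i) := fun e =>
    Finset.sum_nonneg fun i _ => hf _
  match x with
  | cut 0 => exact div_nonneg (add_nonneg (this _) (this _)) (by positivity)
  | cut (n + 1) => exact div_nonneg (add_nonneg (this _) (this _)) (by positivity)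
  | mid n i => exact div_nonneg (add_nonneg (hf _) (hf _)) (by positivity)
  | node b w i =>
    simp only [avg]
    split_ifs
    · exact div_nonneg (add_nonneg (hf _) (hf _)) (by positivity)
    · exact div_nonneg (add_nonneg (hf _) (this _)) (by positivity)

lemma stepE_hit_lineTree (hN : ∀ n, 0 < N n) (A : Set (Vtx N L B)) (x : Vtx N L B) :
    stepE (lineTree N L B) (hit (lineTree N L B) A) x =
      ENNReal.ofReal (avg (hitR (lineTree N L B) A) x) := by
  rw [← stepE_lineTree hN fun _ => hitR_nonneg]
  simp only [ofReal_hitR]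

lemma avg_hitR_le (hN : ∀ n, 0 < N n) (A : Set (Vtx N L B)) (x : Vtx N L B) :
    avg (hitR (lineTree N L B) A) x ≤ hitR (lineTree N L B) A x := by
  have h := stepE_hit_le (G := lineTree N L B) A x
  rw [stepE_hit_lineTree hN, ← ofReal_hitR] at h
  exact (ENNReal.ofReal_le_ofReal_iff hitR_nonneg).1 h

lemma avg_hitR_eq (hN : ∀ n, 0 < N n) {A : Set (Vtx N L B)} {x : Vtx N L B} (hx : x ∉ A) :
    avg (hitR (lineTree N L B) A) x = hitR (lineTree N L B) A x := by
  have h := hit_of_notMem (G := lineTree N L B) hx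
  rw [stepE_hit_lineTree hN, ← ofReal_hitR] at h
  exact ((ENNReal.ofReal_eq_ofReal_iff hitR_nonneg (avg_nonneg (fun _ => hitR_nonneg) _)).1 h).symm

lemma isTransientSubset_of_avg (hN : ∀ n, 0 < N n) {A : Set (Vtx N L B)} {g : Vtx N L B → ℝ}
    (hg : ∀ x, 0 ≤ g x) {c : ℝ} (hc : 0 < c) (h : ∀ x, avg g x ≤ g x)
    (hA : ∀ x ∈ A, avg g x + c ≤ g x) : IsTransientSubset (lineTree N L B) A := by
  refine isTransientSubset_of_potential (fun x => ENNReal.ofReal (g x)) (by simp)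
    (c := ENNReal.ofReal c) (by simpa using hc) fun x => ?_
  rw [stepE_lineTree hN hg]
  by_cases hx : x ∈ A
  · rw [indicator_of_mem hx, ← ENNReal.ofReal_add (avg_nonneg hg x) hc.le]
    exact ENNReal.ofReal_le_ofReal (hA x hx)
  · rw [indicator_of_notMem hx, add_zero]
    exact ENNReal.ofReal_le_ofReal (h x)

/-- Harmonicity at the midpoints and at a cut point makes the flow along the line constant. -/
lemma flow_eq_of_harmonic (hN : ∀ n, 0 < N n) {f : Vtx N L B → ℝ} {n : ℕ}
    (h0 : ∀ i, avg f (mid n i) = f (mid n i))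
    (h1 : ∀ i, avg f (mid (n + 1) i) = f (mid (n + 1) i))
    (hc : avg f (cut (n + 1)) = f (cut (n + 1))) :
    N (n + 1) * (f (cut (n + 2)) - f (cut (n + 1))) = N n * (f (cut (n + 1)) - f (cut n)) := by
  have p0 : (0 : ℝ) < N n := by exact_mod_cast hN n
  have p1 : (0 : ℝ) < N (n + 1) := by exact_mod_cast hN (n + 1)
  simp only [avg] at h0 h1 hc
  simp only [← h0, ← h1, Finset.sum_const, Finset.card_univ, Fintype.card_fin, nsmul_eq_mul] at hc
  rw [div_eq_iff (by positivity)] at hc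
  linarith

end Average

/-! ### Borel–Cantelli for blocks of edges -/

section Percolation

variable {V : Type*} {G : SimpleGraph V} {p : I}

instance : IsProbabilityMeasure (bondMeasure G p) := by
  unfold bondMeasure; infer_instance

lemma bondMeasure_forall_eq (b : Bool) (S : Finset G.edgeSet) :
    bondMeasure G p {ω | ∀ e ∈ S, ω e = b} = bernoulliMeasure true false p {b} ^ S.card := by
  have : {ω : G.edgeSet → Bool | ∀ e ∈ S, ω e = b} = Set.pi S fun _ => {b} := by
    ext; simp [Set.mem_pi]
  have h := Measure.infinitePi_pi (μ := fun _ : G.edgeSet => bernoulliMeasure true false p)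
    (s := S) (t := fun _ => {b}) fun _ _ => .of_discrete
  rw [this, bondMeasure, h, Finset.prod_const]

/-- Disjoint blocks of edges are infinitely often entirely in state `b` if the probabilities
sum to infinity. -/
lemma ae_frequently_forall_eq (b : Bool) {S : ℕ → Finset G.edgeSet}
    (hS : Pairwise fun m n => Disjoint (S m) (S n))
    (hsum : ∑' n, bernoulliMeasure true false p {b} ^ (S n).card = ∞) :
    ∀ᵐ ω ∂bondMeasure G p, ∃ᶠ n in atTop, ∀ e ∈ S n, ω e = b := by
  classical
  set E : ℕ → Set (G.edgeSet → Bool) := fun n => {ω | ∀ e ∈ S n, ω e = b}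
  have hE : ∀ n, MeasurableSet (E n) := by
    intro n
    have : E n = ⋂ e ∈ S n, (fun ω : G.edgeSet → Bool => ω e) ⁻¹' {b} := by ext; simp [E]
    rw [this]
    exact .biInter (S n).countable_toSet fun e _ => measurable_pi_apply e .of_discrete
  -- A finite intersection of these events prescribes the state on a disjoint union of blocks, whose
  -- cardinalities add in the exponent.
  have hind : iIndepSet E (bondMeasure G p) := by
    rw [iIndepSet_iff_meas_biInter hE]
    intro s
    have : ⋂ i ∈ s, E i = {ω | ∀ e ∈ s.biUnion S, ω e = b} := by
      ext ω
      simp only [mem_iInter, E, mem_ofPred_eq, Finset.mem_biUnion]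
      grind
    rw [this, bondMeasure_forall_eq, Finset.card_biUnion fun i _ j _ hij => hS hij,
      ← Finset.prod_pow_eq_pow_sum]
    simp only [E, bondMeasure_forall_eq]
  have h1 := measure_limsup_eq_one hE hind (by simpa only [E, bondMeasure_forall_eq] using hsum)
  have hlim : MeasurableSet (limsup E atTop) := .measurableSet_limsup hE
  have h2 : (limsup E atTop) ∈ ae (bondMeasure G p) := (prob_compl_eq_zero_iff hlim).2 h1
  filter_upwards [h2] with ω hω
  exact mem_limsup_iff_frequently_mem.1 hω

lemma bernoulliMeasure_true : bernoulliMeasure true false p {true} = ENNReal.ofReal p := by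
  rw [bernoulliMeasure_apply_of_mem_of_notMem p .of_discrete (by simp) (by simp)]
  rw [ENNReal.ofReal, unitInterval.toNNReal, Real.toNNReal_of_nonneg p.2.1]
  rfl

lemma bernoulliMeasure_false : bernoulliMeasure true false p {false} = ENNReal.ofReal (1 - p) := by
  rw [bernoulliMeasure_apply_of_notMem_of_mem p .of_discrete (by simp) (by simp)]
  rw [ENNReal.ofReal, unitInterval.toNNReal, Real.toNNReal_of_nonneg (sub_nonneg.2 p.2.2)]
  rfl

/-- At a positive parameter, every infinite set of edges almost surely has infinitely many open
edges. -/
lemma ae_infinite_open (hp : 0 < p) {E : Set G.edgeSet} (hE : E.Infinite) :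
    ∀ᵐ ω ∂bondMeasure G p, {e ∈ E | ω e = true}.Infinite := by
  have := hE.to_subtype
  let φ := Infinite.natEmbedding E
  have hφ : ∀ m n, (φ m : G.edgeSet) = φ n → m = n := fun m n h => φ.injective (Subtype.ext h)
  filter_upwards [ae_frequently_forall_eq (p := p) true (S := fun n => {(φ n : G.edgeSet)})
    (fun m n hmn => by
      exact Finset.disjoint_singleton.2 fun h => hmn (hφ m n h))
    (by
      simp only [Finset.card_singleton, pow_one]
      refine ENNReal.tsum_const_eq_top_of_ne_zero ?_
      rw [bernoulliMeasure_true]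
      simpa using hp)] with ω hω
  have h1 : {n | ω (φ n) = true}.Infinite := by
    refine Nat.frequently_atTop_iff_infinite.1 ?_
    simpa using hω
  have h2 := h1.image (f := fun n => (φ n : G.edgeSet)) fun m _ n _ h => hφ m n h
  refine h2.mono ?_
  rintro _ ⟨n, hn, rfl⟩
  exact ⟨(φ n).2, hn⟩

lemma reachable_subset_of_closed {ω : G.edgeSet → Bool} {S : Set V} {x : V} (hx : x ∈ S)
    (hS : ∀ a b, (openGraph G ω).Adj a b → a ∈ S → b ∈ S) : (cluster G ω x).verts ⊆ S := by
  rintro y ⟨q⟩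
  induction q with
  | nil => exact hx
  | cons hab _ ih => exact ih (hS _ _ hab hx)

lemma mem_enlargement_verts {ω : G.edgeSet → Bool} {A : Set V} {y : V} :
    y ∈ (enlargement G ω (inducedSubgraph G A)).verts ↔
      ∃ a ∈ A, (openGraph G ω).Reachable a y := by
  simp [enlargement, inducedSubgraph, cluster]

end Percolation

/-- The edge joining `mid n i` to `cut n`. -/
def loEdge (n : ℕ) (i : Fin (N n)) : (lineTree N L B).edgeSet :=
  ⟨s(mid n i, cut n), .inl (.lo n i)⟩

lemma loEdge_inj {m n : ℕ} {i : Fin (N m)} {j : Fin (N n)} :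
    (loEdge m i : (lineTree N L B).edgeSet) = loEdge n j ↔
      (mid m i : Vtx N L B) = mid n j := by
  rw [Subtype.ext_iff]
  change s(_, _) = s(_, _) ↔ _
  rw [Sym2.eq_iff]
  constructor
  · rintro (h | h)
    · exact h.1
    · simp at h
  · intro h
    exact .inl ⟨h, by rw [(mid.inj h).1]⟩

/-! ### A line with exponentially growing multiplicities -/

/-- A line of cut points, consecutive ones joined by `2 ^ n` paths of length two. -/
abbrev thickLine : SimpleGraph (Vtx (fun n => 2 ^ n) 0 Empty) := lineTree (fun n => 2 ^ n) 0 Empty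

/-- Without a tree no flow enters at `cut 0`, and harmonicity before `cut m` propagates zero flow
from level to level. The hitting probability is therefore constant up to `cut m`, where it is `1`.
-/
lemma hitR_cut_of_le [Fintype B] [IsEmpty B] (hN : ∀ n, 0 < N n) {n m : ℕ} (h : n ≤ m) :
    hitR (lineTree N L B) {cut m} (cut n) = 1 := by
  set f := hitR (lineTree N L B) {cut m} with hf
  have hp : ∀ n, (0 : ℝ) < N n := fun n => by exact_mod_cast hN n
  have hm : ∀ n i, avg f (mid n i) = f (mid n i) := fun n i => avg_hitR_eq hN (by simp)
  have hflow : ∀ n, n < m → N n * (f (cut (n + 1)) - f (cut n)) = 0 := by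
    intro n
    induction n with
    | zero =>
      intro h0
      have h1 : avg f (cut 0) = f (cut 0) := avg_hitR_eq hN (by simpa using h0.ne)
      have h2 := hm 0
      simp only [avg] at h1 h2
      simp only [← h2, Finset.sum_const, Finset.card_univ, Fintype.card_fin, nsmul_eq_mul,
        Fintype.card_eq_zero, Finset.univ_eq_empty, Finset.sum_empty] at h1
      rw [div_eq_iff (by simpa using (hp 0).ne')] at h1
      push_cast at h1
      linarith
    | succ n ih =>
      intro h0
      rw [flow_eq_of_harmonic hN (hm n) (hm (n + 1)) (avg_hitR_eq hN (by simpa using h0.ne))]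
      exact ih (by omega)
  induction h using Nat.decreasingInduction with
  | self => exact hitR_of_mem rfl
  | of_succ k hk ih =>
    have := (mul_eq_zero.1 (hflow k hk)).resolve_left (hp k).ne'
    linarith

/-- On a line without a tree, infinitely many cut points form a recurrent set. -/
lemma isRecurrentSubset_of_infinite_cut [Fintype B] [IsEmpty B] (hN : ∀ n, 0 < N n)
    {C : Set (Vtx N L B)} (hC : {n | cut n ∈ C}.Infinite) :
    IsRecurrentSubset (lineTree N L B) C := by
  have : Nonempty (Vtx N L B) := ⟨cut 0⟩
  refine isRecurrentSubset_of_hit_eq_one fun x => le_antisymm (hit_le_one _ _) ?_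
  have key : ∀ x : Vtx N L B, ∃ k, ∀ m ≥ k, hitR (lineTree N L B) {cut m} x = 1 := by
    intro x
    cases x with
    | cut n => exact ⟨n, fun m hm => hitR_cut_of_le hN hm⟩
    | mid n i =>
      refine ⟨n + 1, fun m hm => ?_⟩
      rw [← avg_hitR_eq hN (by simp)]
      simp only [avg]
      rw [hitR_cut_of_le hN (by omega), hitR_cut_of_le hN hm]
      norm_num
    | node b w i => exact isEmptyElim b
  obtain ⟨k, hk⟩ := key x
  obtain ⟨m, hm, hkm⟩ := hC.exists_gt k
  have h1 := mul_hit_le (X := {cut m}) (δ := 1) (stepE_hit_le (G := lineTree N L B) C)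
    (fun y hy => by rw [mem_singleton_iff.1 hy, hit_of_mem (show cut m ∈ C from hm)]) x
  rwa [one_mul, ← ofReal_hitR, hk m hkm.le, ENNReal.ofReal_one] at h1

/-- A potential decaying along the line, raised by `1` at the chosen midpoint of each level, loses
at least `1` in mean at each point of the set. -/
lemma isTransientSubset_thickLine :
    IsTransientSubset thickLine ({cut 0} ∪ range fun n => mid n ⟨0, by positivity⟩) := by
  -- Chosen so that `2 ^ n * (α n - α (n + 1)) = 8 * (n + 1)`. The flow, halved by the midpoints,
  -- grows by `4` per level, which pays for the two raised neighbours of a cut point.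
  let α : ℕ → ℝ := fun n => 16 * (n + 2) / 2 ^ n
  have hα : ∀ n, 0 ≤ α n := fun n => by positivity
  have hd : ∀ n, 2 ^ n * α (n + 1) = 2 ^ n * α n - 8 * (n + 1) := by
    intro n
    simp only [α, pow_succ]
    push_cast
    field_simp
    ring
  let g : Vtx (fun n => 2 ^ n) 0 Empty → ℝ
    | cut n => α n
    | mid n i => (α n + α (n + 1)) / 2 + if i = ⟨0, by positivity⟩ then 1 else 0
    | node b _ _ => b.elim
  have hsum : ∀ n : ℕ, ∑ i : Fin (2 ^ n), g (mid n i) = 2 ^ n * ((α n + α (n + 1)) / 2) + 1 := by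
    intro n
    simp only [g, Finset.sum_add_distrib, Finset.sum_ite_eq', Finset.mem_univ, if_true,
      Finset.sum_const, Finset.card_univ, Fintype.card_fin, nsmul_eq_mul]
    push_cast
    ring
  have hcut0 : avg g (cut 0) + 1 ≤ g (cut 0) := by
    simp only [avg, hsum]
    simp [α, g]
    norm_num
  have hcut : ∀ n, avg g (cut n) ≤ g (cut n) := by
    intro n
    cases n with
    | zero => linarith
    | succ n =>
      simp only [avg, hsum]
      have e : g (cut (n + 1)) = α (n + 1) := rfl
      push_cast
      rw [e, div_le_iff₀ (by positivity)]
      have h1 := hd n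
      have h2 := hd (n + 1)
      have h3 : (2 : ℝ) ^ (n + 1) = 2 * 2 ^ n := by ring
      push_cast at h2
      rw [h3] at h2 ⊢
      linarith
  have hmid : ∀ n i, avg g (mid n i) + (if i = ⟨0, by positivity⟩ then 1 else 0) = g (mid n i) := by
    intro n i
    simp [avg, g]
  refine isTransientSubset_of_avg (g := g) (c := 1) (fun n => by positivity) ?_ one_pos ?_ ?_
  · rintro (n | ⟨n, i⟩ | b)
    · exact hα n
    · have := hα n
      have := hα (n + 1)
      simp only [g]
      split_ifs <;> positivity
    · exact b.elim
  · rintro (n | ⟨n, i⟩ | b)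
    · exact hcut n
    · rw [← hmid n i]
      split_ifs <;> linarith
    · exact b.elim
  · rintro _ (rfl | ⟨n, rfl⟩)
    · exact hcut0
    · rw [← hmid, if_pos rfl]

lemma pc2_thickLine {A : Set (Vtx (fun n => 2 ^ n) 0 Empty)} (hinf : A.Infinite)
    (hA : IsTransientSubset thickLine A) :
    pc2 thickLine (inducedSubgraph thickLine A) (BeingRecurrentSubset thickLine) = 0 := by
  have hN : ∀ n, 0 < (fun n => 2 ^ n) n := fun n => by positivity
  have hcut : {n | cut n ∈ A}.Finite := by
    by_contra h
    exact hA (isRecurrentSubset_of_infinite_cut hN h)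
  set E : Set thickLine.edgeSet := {e | ∃ n i, mid n i ∈ A ∧ e = loEdge n i} with hE
  have hEinf : E.Infinite := by
    intro hfin
    refine hinf ?_
    have h1 : {x | ∃ n i, x = mid n i ∧ x ∈ A}.Finite := by
      refine Set.Finite.of_finite_image (f := fun x => match x with
        | mid n i => some (loEdge n i : thickLine.edgeSet)
        | _ => none) ((hfin.image some).subset ?_) ?_
      · rintro _ ⟨_, ⟨n, i, rfl, h⟩, rfl⟩
        exact ⟨_, ⟨n, i, h, rfl⟩, rfl⟩
      · rintro _ ⟨n, i, rfl, -⟩ _ ⟨m, j, rfl, -⟩ h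
        simpa [loEdge_inj] using h
    refine (h1.union (hcut.image cut)).subset fun x hx => ?_
    cases x with
    | cut n => exact .inr ⟨n, hx, rfl⟩
    | mid n i => exact .inl ⟨n, i, rfl, hx⟩
    | node b _ _ => exact b.elim
  have hmain : ∀ p : I, 0 < p → bondMeasure thickLine p
      {ω | BeingRecurrentSubset thickLine (enlargement thickLine ω (inducedSubgraph thickLine A))}
        = 1 := by
    intro p hp
    refine (measure_eq_measure_of_null_sdiff (subset_univ _) ?_).trans measure_univ
    rw [← compl_eq_univ_sdiff]
    have : ∀ᵐ ω ∂bondMeasure thickLine p, BeingRecurrentSubset thickLine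
        (enlargement thickLine ω (inducedSubgraph thickLine A)) := by
      -- Each level has finitely many midpoints, so infinitely many open edges reach infinitely many
      -- cut points.
      filter_upwards [ae_infinite_open hp hEinf] with ω hω
      refine isRecurrentSubset_of_infinite_cut hN fun hfin => hω ?_
      have h2 : (⋃ n ∈ {n | cut n ∈ (enlargement thickLine ω (inducedSubgraph thickLine A)).verts},
          range fun i : Fin (2 ^ n) => (loEdge n i : thickLine.edgeSet)).Finite :=
        hfin.biUnion fun n _ => finite_range _
      refine h2.subset ?_
      rintro _ ⟨⟨n, i, hi, rfl⟩, hopen⟩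
      refine mem_biUnion (x := n) ?_ ⟨i, rfl⟩
      have hadj : (openGraph thickLine ω).Adj (mid n i) (cut n) := ⟨(loEdge n i).2, hopen⟩
      exact mem_enlargement_verts.2 ⟨_, hi, hadj.reachable⟩
    exact this
  refine le_antisymm (le_of_forall_gt_imp_ge_of_dense fun p hp => ?_) bot_le
  exact sInf_le (hmain p hp)

theorem exists_pc2_eq_zero : ∃ (V : Type) (G : SimpleGraph V), IsAdmissible G ∧
    (∃ A : Set V, A.Infinite ∧ IsTransientSubset G A) ∧
    ∀ A : Set V, A.Infinite → IsTransientSubset G A →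
      pc2 G (inducedSubgraph G A) (BeingRecurrentSubset G) = 0 := by
  refine ⟨_, thickLine, isAdmissible_lineTree (fun n => by positivity)
    (isTransientSubset_thickLine.mono subset_union_left), ⟨_, ?_, isTransientSubset_thickLine⟩,
    fun A h1 h2 => pc2_thickLine h1 h2⟩
  refine Infinite.mono subset_union_right (infinite_range_of_injective fun m n h => ?_)
  exact (mid.inj h).1

/-! ### A recurrent line with a transient subdivided binary tree attached -/

/-- The multiplicities of the line grow logarithmically. -/
def logMult (n : ℕ) : ℕ := Nat.log 2 (n + 1) + 1

/-- The chains at depth `k` of the tree have `(k + 1) ^ 2` edges. -/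
def sqLen (k : ℕ) : ℕ := k * (k + 2)

/-- The vertices of the line with a subdivided binary tree. -/
abbrev LTVtx : Type := Vtx logMult sqLen Bool

/-- The line with logarithmic multiplicities and a subdivided binary tree attached. -/
abbrev thinTree : SimpleGraph LTVtx := lineTree logMult sqLen Bool

lemma logMult_pos (n : ℕ) : 0 < logMult n := Nat.succ_pos _

lemma sqLen_succ (k : ℕ) : ((sqLen k : ℕ) : ℝ) + 1 = (k + 1) ^ 2 := by
  simp only [sqLen]; push_cast; ring

/-- The potential is constant on the line and is that of a flow splitting equally at each junction
of the tree; it drops in mean by `2 / 3` at the root. -/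
lemma isTransientSubset_root : IsTransientSubset thinTree {cut 0} := by
  -- Closed form of the tail `∑ j ≥ k, (j + 1) ^ 2 / 2 ^ j`, the potential at depth `k` when chains
  -- there have slope `1 / 2 ^ k`.
  let h : ℕ → ℝ := fun k => (2 * k ^ 2 + 8 * k + 12) / 2 ^ k
  have hh : ∀ k, h k - (k + 1) ^ 2 / 2 ^ k = h (k + 1) := by
    intro k
    simp only [h, pow_succ]
    push_cast
    field_simp
    ring
  let g : LTVtx → ℝ
    | cut _ => 12
    | mid _ _ => 12
    | node _ w i => h w.length - (i.val + 1) / 2 ^ w.length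
  have hbase : ∀ w, g (base w) = h w.length := by
    intro w
    cases w with
    | nil => simp [base, g, h]
    | cons b w => simp only [base, g, Fin.val_last, sqLen_succ, hh, List.length_cons]
  have hchain : ∀ b w j, j ≤ sqLen w.length + 1 →
      g (chainPt b w j) = h w.length - j / 2 ^ w.length := by
    intro b w j hj
    cases j with
    | zero => simp [chainPt, hbase]
    | succ j =>
      have := chainPt_succ (N := logMult) (L := sqLen) b w ⟨j, by omega⟩
      simp only at this
      rw [this]
      simp [g]
  refine isTransientSubset_of_avg (g := g) (c := 1 / 2) logMult_pos ?_ (by norm_num) ?_ ?_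
  · rintro (n | ⟨n, i⟩ | ⟨b, w, i⟩)
    · simp [g]
    · simp [g]
    · have h1 := hh w.length
      have h2 : (i.val + 1 : ℝ) / 2 ^ w.length ≤ (w.length + 1) ^ 2 / 2 ^ w.length := by
        rw [← sqLen_succ]
        gcongr
        omega
      have h3 : 0 ≤ h (w.length + 1) := by positivity
      simp only [g]
      linarith
  · have hN : ∀ n, (0 : ℝ) < logMult n := fun n => by exact_mod_cast logMult_pos n
    intro x
    match x with
    | cut 0 =>
      have := hN 0
      simp only [avg]
      rw [div_le_iff₀ (by positivity)]
      simp [g, h]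
      linarith
    | cut (n + 1) =>
      have h1 := hN n
      have h2 := hN (n + 1)
      simp only [avg]
      rw [div_le_iff₀ (by positivity)]
      simp [g]
      linarith
    | mid n i => simp [avg, g]
    | node b w i =>
      simp only [avg]
      split_ifs with hi
      · rw [hchain b w _ (by omega), hchain b w _ (by omega), ← chainPt_succ,
          hchain b w _ (by omega)]
        push_cast
        apply le_of_eq
        ring
      · obtain rfl : i = Fin.last _ := Fin.ext (by simp; omega)
        have e : (node b w (Fin.last _) : LTVtx) = base (b :: w) := rfl
        rw [hchain b w _ (by simp), e, hbase, div_le_iff₀ (by positivity)]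
        have h1 := hh w.length
        have h2 := sqLen_succ w.length
        have h3 : (sqLen w.length : ℝ) / 2 ^ w.length =
          (w.length + 1) ^ 2 / 2 ^ w.length - 1 / 2 ^ w.length := by
          rw [← h2]; ring
        have h4 : (1 : ℝ) / 2 ^ (w.length + 1) = 1 / 2 ^ w.length / 2 := by
          rw [pow_succ]; ring
        simp only [g, Fin.val_last, List.length_cons, Fintype.card_bool, Finset.sum_const,
          Finset.card_univ, Fin.val_zero, h3, nsmul_eq_mul, Nat.cast_zero, zero_add, h4]
        push_cast
        linarith
  · rintro _ rfl
    simp [avg, g, h]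
    norm_num [logMult]

/-- Away from the origin the flow along the line is constant, so level `n` lowers the hitting
probability by `d / logMult n ≥ d / (n + 1)`. Divergence of the harmonic series and nonnegativity
force `d = 0`. -/
lemma hitR_root_cut (n : ℕ) : hitR thinTree {cut 0} (cut n) = 1 := by
  set f := hitR thinTree {cut 0} with hf
  have hm : ∀ n i, avg f (mid n i) = f (mid n i) := fun n i => avg_hitR_eq logMult_pos (by simp)
  have hflow : ∀ n, logMult n * (f (cut (n + 1)) - f (cut n)) = f (cut 1) - f (cut 0) := by
    intro n
    induction n with
    | zero => simp [logMult]
    | succ n ih =>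
      rw [← ih]
      exact flow_eq_of_harmonic logMult_pos (hm n) (hm (n + 1)) (avg_hitR_eq logMult_pos (by simp))
  have h0 : f (cut 0) = 1 := hitR_of_mem rfl
  set d := f (cut 0) - f (cut 1) with hd
  have hd0 : 0 ≤ d := by
    rw [hd, h0]
    linarith [hitR_le_one (G := thinTree) (A := {cut 0}) (x := cut 1)]
  have hN : ∀ n, (0 : ℝ) < logMult n := fun n => by exact_mod_cast logMult_pos n
  have hstep : ∀ n, f (cut (n + 1)) = f (cut n) - d / logMult n := by
    intro n
    have := hflow n
    have h1 := hN n
    field_simp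
    linarith
  have hle : ∀ n, f (cut n) ≤ 1 - d * ∑ k ∈ Finset.range n, 1 / ((k : ℝ) + 1) := by
    intro n
    induction n with
    | zero => simp [h0]
    | succ n ih =>
      rw [hstep, Finset.sum_range_succ]
      have h1 : d * (1 / ((n : ℝ) + 1)) ≤ d / logMult n := by
        rw [mul_one_div]
        have h2 : (logMult n : ℝ) ≤ n + 1 := by
          have := Nat.log_lt_self 2 (show n + 1 ≠ 0 by omega)
          have h3 : logMult n ≤ n + 1 := by simp only [logMult]; omega
          exact_mod_cast h3
        exact div_le_div_of_nonneg_left hd0 (hN n) h2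
      linarith
  have hdz : d = 0 := by
    by_contra hne
    have hpos : 0 < d := lt_of_le_of_ne hd0 (Ne.symm hne)
    have ht := (Real.tendsto_sum_range_one_div_nat_succ_atTop).const_mul_atTop hpos
    obtain ⟨n, hn⟩ := (ht.eventually_gt_atTop 1).exists
    have h1 := hle n
    have h2 : 0 ≤ f (cut n) := hitR_nonneg
    linarith
  induction n with
  | zero => exact h0
  | succ n ih => rw [hstep, ih, hdz]; simp

/-- The vertices of the line. -/
def lineSet : Set LTVtx := range cut ∪ {x | ∃ n i, x = mid n i}

lemma isTransientSubset_lineSet : IsTransientSubset thinTree lineSet := by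
  refine isTransientSubset_root.of_le_hit one_ne_zero ?_
  rintro _ (⟨n, rfl⟩ | ⟨n, i, rfl⟩)
  · rw [← ofReal_hitR, hitR_root_cut, ENNReal.ofReal_one]
  · rw [← ofReal_hitR, ← avg_hitR_eq logMult_pos (by simp)]
    simp only [avg]
    rw [hitR_root_cut, hitR_root_cut]
    norm_num

/-! ### Concavity along chains and a Harnack inequality at junctions -/

lemma concave_increment {c : ℕ → ℝ} {M : ℕ} (hc : ∀ j, j + 2 ≤ M → c j + c (j + 2) ≤ 2 * c (j + 1))
    {i j : ℕ} (hij : i ≤ j) (hj : j + 1 ≤ M) : c (j + 1) - c j ≤ c (i + 1) - c i := by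
  induction j, hij using Nat.le_induction with
  | base => rfl
  | succ j hij ih =>
    have := ih (by omega)
    have := hc j (by omega)
    linarith

lemma concave_secant {c : ℕ → ℝ} {M : ℕ} (hc : ∀ j, j + 2 ≤ M → c j + c (j + 2) ≤ 2 * c (j + 1))
    {j : ℕ} (hj : j ≤ M) : c j - c 0 ≤ j * (c 1 - c 0) := by
  induction j with
  | zero => simp
  | succ j ih =>
    have h1 := ih (by omega)
    have h2 := concave_increment hc (Nat.zero_le j) hj
    push_cast
    linarith

lemma concave_secant_rev {c : ℕ → ℝ} {M : ℕ}
    (hc : ∀ j, j + 2 ≤ M → c j + c (j + 2) ≤ 2 * c (j + 1)) {j : ℕ} (hj : j ≤ M) :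
    c j - c M ≤ (M - j : ℕ) * (c (M - 1) - c M) := by
  have h := concave_secant (c := fun i => c (M - i)) (M := M) (j := M - j) ?_ (by omega)
  · simpa [Nat.sub_sub_self hj] using h
  · intro i hi
    have := hc (M - (i + 2)) (by omega)
    rw [show M - (i + 2) + 2 = M - i by omega, show M - (i + 2) + 1 = M - (i + 1) by omega] at this
    linarith

lemma concave_min {c : ℕ → ℝ} {M : ℕ} (hc : ∀ j, j + 2 ≤ M → c j + c (j + 2) ≤ 2 * c (j + 1))
    {j : ℕ} (hj : j ≤ M) {η : ℝ} (h0 : η ≤ c 0) (hM : η ≤ c M) : η ≤ c j := by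
  rcases hj.eq_or_lt with rfl | hj
  · exact hM
  rcases le_total 0 (c (j + 1) - c j) with h | h
  · have : ∀ i ≤ j, c 0 ≤ c i := by
      intro i hi
      induction i with
      | zero => rfl
      | succ i ih =>
        have h1 := ih (by omega)
        have h2 := concave_increment hc (show i ≤ j by omega) (by omega)
        linarith
    exact h0.trans (this j le_rfl)
  · have : ∀ i, j ≤ i → i ≤ M → c i ≤ c j := by
      intro i hi
      induction i, hi using Nat.le_induction with
      | base => exact fun _ => le_rfl
      | succ i hi ih =>
        intro hiM
        have h1 := ih (by omega)
        have h2 := concave_increment hc hi (by omega)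
        linarith
    exact hM.trans (this M hj.le le_rfl)

section Superharmonic

variable {u : LTVtx → ℝ}

lemma chain_concave (hu : ∀ x, avg u x ≤ u x) (b : Bool) (w : List Bool) :
    ∀ j, j + 2 ≤ sqLen w.length + 1 →
      u (chainPt b w j) + u (chainPt b w (j + 2)) ≤ 2 * u (chainPt b w (j + 1)) := by
  intro j hj
  have h := hu (node b w ⟨j, by omega⟩)
  simp only [avg] at h
  rw [if_pos (by omega), ← chainPt_succ] at h
  simp only at h
  linarith

lemma superharmonic_junction (hu : ∀ x, avg u x ≤ u x) (b : Bool) (w : List Bool) :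
    u (chainPt b w (sqLen w.length)) + u (chainPt true (b :: w) 1) + u (chainPt false (b :: w) 1) ≤
      3 * u (base (b :: w)) := by
  have h := hu (node b w (Fin.last _))
  simp only [avg, Fin.val_last, lt_irrefl, if_false, Fintype.card_bool, Fintype.sum_bool] at h
  rw [div_le_iff₀ (by norm_num)] at h
  have e : ∀ c, (chainPt c (b :: w) 1 : LTVtx) = node c (b :: w) 0 := fun c =>
    chainPt_succ c (b :: w) 0
  rw [e, e, base]
  push_cast at h
  linarith

/-- Lower bound for the first step of a chain seen from its upper end. -/
lemma le_chain_one (hu0 : ∀ x, 0 ≤ u x) (hu : ∀ x, avg u x ≤ u x) (b : Bool) (w : List Bool) :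
    -u (base w) ≤ ((w.length : ℝ) + 1) ^ 2 * (u (chainPt b w 1) - u (base w)) := by
  have h := concave_secant (chain_concave hu b w) le_rfl
  have h1 := hu0 (chainPt b w (sqLen w.length + 1))
  push_cast at h
  rw [sqLen_succ] at h
  simp only [chainPt] at h h1 ⊢
  linarith

lemma le_chain_last (hu0 : ∀ x, 0 ≤ u x) (hu : ∀ x, avg u x ≤ u x) (b : Bool) (w : List Bool) :
    -u (base (b :: w)) ≤
      ((w.length : ℝ) + 1) ^ 2 * (u (chainPt b w (sqLen w.length)) - u (base (b :: w))) := by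
  have h := concave_secant_rev (chain_concave hu b w) (Nat.zero_le _)
  have h1 := hu0 (chainPt b w 0)
  simp only [Nat.sub_zero, Nat.add_sub_cancel, chainPt_last] at h
  push_cast at h
  rw [sqLen_succ] at h
  linarith

/-- If `u` were much larger on the incoming chain than at the junction, concavity would force a
steep rise into that chain. Superharmonicity requires the other two chains to compensate, but `u ≥
0` bounds their descent by the value at the junction over their length. -/
lemma le_mul_junction_of_up (hu0 : ∀ x, 0 ≤ u x) (hu : ∀ x, avg u x ≤ u x) {b : Bool}
    {w : List Bool} {j : ℕ} (hj : j ≤ sqLen w.length + 1) {η : ℝ} (h : η ≤ u (chainPt b w j)) :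
    η ≤ 6 * u (base (b :: w)) := by
  have hx := hu0 (base (b :: w))
  have hs := superharmonic_junction hu b w
  have h1 := le_chain_one hu0 hu true (b :: w)
  have h2 := le_chain_one hu0 hu false (b :: w)
  have h3 := concave_secant_rev (chain_concave hu b w) hj
  simp only [Nat.add_sub_cancel, chainPt_last] at h3
  simp only [List.length_cons] at h1 h2
  push_cast at h1 h2
  have h4 : ((sqLen w.length + 1 - j : ℕ) : ℝ) ≤ ((w.length : ℝ) + 1) ^ 2 := by
    rw [← sqLen_succ]
    exact_mod_cast Nat.sub_le _ _
  set x := u (base (b :: w))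
  set y := u (chainPt b w (sqLen w.length)) - x with hy
  set k : ℝ := (w.length : ℝ) with hkdef
  have hk : 0 ≤ k := by positivity
  by_contra! hlt
  have hy0 : 0 < y := by
    by_contra! hy0
    nlinarith [Nat.cast_nonneg (α := ℝ) (sqLen w.length + 1 - j)]
  have h5 : 5 * x < (k + 1) ^ 2 * y := by nlinarith
  have h6 : (k + 1 + 1) ^ 2 * y ≤ 2 * x := by nlinarith
  nlinarith

/-- The same argument with the large value on an outgoing chain. The constant is `6 = 1 + 1 + 4`:
the sibling chain has equal length and contributes `1`, while the shorter incoming chain contributes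
`4`, since `(k + 2) ^ 2 ≤ 4 * (k + 1) ^ 2`. -/
lemma le_mul_junction_of_down (hu0 : ∀ x, 0 ≤ u x) (hu : ∀ x, avg u x ≤ u x) {b c : Bool}
    {w : List Bool} {j : ℕ} (hj : j ≤ sqLen (w.length + 1) + 1) {η : ℝ}
    (h : η ≤ u (chainPt c (b :: w) j)) : η ≤ 6 * u (base (b :: w)) := by
  have hx := hu0 (base (b :: w))
  have hs := superharmonic_junction hu b w
  have h0 := le_chain_last hu0 hu b w
  have h1 := le_chain_one hu0 hu (!c) (b :: w)
  have h3 := concave_secant (chain_concave hu c (b :: w)) hj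
  have h4 : (j : ℝ) ≤ ((w.length : ℝ) + 1 + 1) ^ 2 := by
    have := sqLen_succ (w.length + 1)
    push_cast at this
    rw [← this]
    exact_mod_cast hj
  have e : (chainPt c (b :: w) 0 : LTVtx) = base (b :: w) := rfl
  rw [e] at h3
  simp only [List.length_cons] at h1
  push_cast at h1
  have hs' : u (chainPt b w (sqLen w.length)) + u (chainPt c (b :: w) 1) +
      u (chainPt (!c) (b :: w) 1) ≤ 3 * u (base (b :: w)) := by
    cases c <;> simp only [Bool.not_true, Bool.not_false] <;> linarith
  set x := u (base (b :: w))
  set y := u (chainPt c (b :: w) 1) - x with hy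
  set z := u (chainPt (!c) (b :: w) 1) - x with hz
  set t := u (chainPt b w (sqLen w.length)) - x with ht
  set k : ℝ := (w.length : ℝ) with hkdef
  have hk : 0 ≤ k := by positivity
  have hsum : t + y + z ≤ 0 := by linarith
  by_contra! hlt
  have hy0 : 0 < y := by
    by_contra! hy0
    nlinarith [Nat.cast_nonneg (α := ℝ) j]
  have h5 : 5 * x < (k + 1 + 1) ^ 2 * y := by nlinarith
  have h6 : -(4 * x) ≤ (k + 1 + 1) ^ 2 * t := by
    rcases le_total 0 t with h7 | h7
    · have : 0 ≤ (k + 1 + 1) ^ 2 * t := by positivity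
      linarith
    · have : (k + 1 + 1) ^ 2 ≤ 4 * (k + 1) ^ 2 := by nlinarith
      nlinarith
  nlinarith

end Superharmonic

/-- The chains that end at `base w`. -/
def star (w : List Bool) : Set LTVtx :=
  {y | ∃ c v j, j ≤ sqLen v.length + 1 ∧ (v = w ∨ c :: v = w) ∧ y = chainPt c v j}

/-- On the star of a junction that is not adjacent to the root, every point is hit from every other
point with probability bounded below. -/
lemma le_hit_of_star {A : Set LTVtx} {b c : Bool} {w : List Bool} {a y : LTVtx} (ha : a ∈ A)
    (haw : a ∈ star (b :: c :: w)) (hy : y ∈ star (b :: c :: w)) :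
    ENNReal.ofReal (1 / 36) ≤ hit thinTree A y := by
  rw [← ofReal_hitR]
  refine ENNReal.ofReal_le_ofReal ?_
  set u := hitR thinTree A
  have hu0 : ∀ x, 0 ≤ u x := fun _ => hitR_nonneg
  have hu : ∀ x, avg u x ≤ u x := avg_hitR_le logMult_pos A
  -- One factor `1 / 6` leads from `a` to the central junction and another to the three neighbouring
  -- ones. Concavity then controls the chains between them. A two-letter address keeps all of these
  -- away from the root.
  have h1 : (1 : ℝ) ≤ 6 * u (base (b :: c :: w)) := by
    have hua : (1 : ℝ) ≤ u a := (hitR_of_mem ha).ge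
    obtain ⟨d, v, j, hj, hv | hv, rfl⟩ := haw
    · subst hv
      exact le_mul_junction_of_down hu0 hu hj hua
    · obtain ⟨rfl, rfl⟩ := List.cons.inj hv
      exact le_mul_junction_of_up hu0 hu hj hua
  have h2 : ∀ d, 1 / 6 ≤ 6 * u (base (d :: b :: c :: w)) := by
    intro d
    refine le_mul_junction_of_up (j := 0) hu0 hu (by omega) ?_
    simp only [chainPt]
    linarith
  have h3 : 1 / 6 ≤ 6 * u (base (c :: w)) := by
    refine le_mul_junction_of_down (c := b) (j := sqLen (w.length + 1) + 1) hu0 hu le_rfl ?_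
    have : (chainPt b (c :: w) (sqLen (w.length + 1) + 1) : LTVtx) = base (b :: c :: w) :=
      chainPt_last b (c :: w)
    rw [this]
    linarith
  obtain ⟨d, v, j, hj, hv | hv, rfl⟩ := hy
  · subst hv
    refine concave_min (chain_concave hu d _) hj ?_ ?_
    · simp only [chainPt]; linarith
    · rw [chainPt_last]; linarith [h2 d]
  · obtain ⟨rfl, rfl⟩ := List.cons.inj hv
    refine concave_min (chain_concave hu d _) hj ?_ ?_
    · simp only [chainPt]; linarith
    · rw [chainPt_last]; linarith

/-! ### Open chains and the enlargement in the tree -/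

section Edges

/-- The edge joining `mid n i` to `cut (n + 1)`. -/
def hiEdge (n : ℕ) (i : Fin (N n)) : (lineTree N L B).edgeSet :=
  ⟨s(mid n i, cut (n + 1)), .inl (.hi n i)⟩

/-- The edge joining `node b w i` to its predecessor on the chain. -/
def chainEdge (b : B) (w : List B) (i : Fin (L w.length + 1)) : (lineTree N L B).edgeSet :=
  ⟨s(node b w i, chainPt b w i), .inl (.chain b w i)⟩

lemma hiEdge_inj {n : ℕ} {i j : Fin (N n)} :
    (hiEdge n i : (lineTree N L B).edgeSet) = hiEdge n j ↔ i = j := by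
  rw [Subtype.ext_iff]
  change s(_, _) = s(_, _) ↔ _
  rw [Sym2.eq_iff]
  simp

lemma loEdge_ne_hiEdge {n : ℕ} {i j : Fin (N n)} :
    (loEdge n i : (lineTree N L B).edgeSet) ≠ hiEdge n j := by
  rw [Ne, Subtype.ext_iff]
  change ¬ s(_, _) = s(_, _)
  rw [Sym2.eq_iff]
  simp

lemma chainEdge_injective (b : B) (w : List B) :
    (chainEdge b w : _ → (lineTree N L B).edgeSet).Injective := by
  intro i j h
  rw [Subtype.ext_iff] at h
  change s(_, _) = s(_, _) at h
  rw [Sym2.eq_iff] at h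
  have key : ∀ i j : Fin (L w.length + 1), (node b w i : Vtx N L B) = chainPt b w j →
      i.val + 1 = j := by
    intro i j hij
    by_cases hi : i.val < L w.length
    · exact ((chainPt_eq_node_iff (by omega) hi).1 hij.symm).2.2.symm
    · obtain rfl : i = Fin.last _ := Fin.ext (by simp; omega)
      have := ((chainPt_eq_base_iff (v := b :: w) (by omega)).1 hij.symm).2
      simp at this
  rcases h with h | ⟨h1, h2⟩
  · simpa using h.1
  · have := key _ _ h1
    have := key _ _ h2.symm
    omega

lemma exists_edge_of_openGraph_adj {ω : (lineTree N L B).edgeSet → Bool} {x y : Vtx N L B}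
    (h : (openGraph (lineTree N L B) ω).Adj x y) :
    ∃ e : Edge x y ∨ Edge y x, ω ⟨s(x, y), e⟩ = true := h

end Edges

/-- The chains all of whose edges are open. -/
def openChains (ω : thinTree.edgeSet → Bool) : Set (Bool × List Bool) :=
  {q | ∀ i, ω (chainEdge q.1 q.2 i) = true}

lemma summable_openChains {r : ℝ} (h0 : 0 ≤ r) (h1 : r < 1) :
    Summable fun n : ℕ => (2 : ℝ) ^ n * r ^ (sqLen n + 1) := by
  have h2 : Tendsto (fun n : ℕ => r ^ (n + 2)) atTop (nhds 0) :=
    (tendsto_pow_atTop_nhds_zero_of_lt_one h0 h1).comp (tendsto_add_atTop_nat 2)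
  refine Summable.of_norm_bounded_eventually_nat (g := fun n => (1 / 2 : ℝ) ^ n)
    (summable_geometric_of_lt_one (by norm_num) (by norm_num)) ?_
  filter_upwards [h2.eventually_le_const (show (0 : ℝ) < 1 / 4 by norm_num)] with n hn
  rw [Real.norm_of_nonneg (by positivity)]
  calc (2 : ℝ) ^ n * r ^ (sqLen n + 1) = (2 * r ^ (n + 2)) ^ n * r := by
        rw [sqLen, mul_pow, ← pow_mul, pow_succ, mul_comm n]; ring
    _ ≤ (1 / 2) ^ n * 1 := by gcongr; linarith
    _ = (1 / 2) ^ n := mul_one _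

/-- First Borel–Cantelli lemma: quadratic chain lengths beat the `2 ^ n` addresses at depth `n` for
every `p < 1`. -/
lemma ae_finite_openChains {p : I} (hp : p < 1) :
    ∀ᵐ ω ∂bondMeasure thinTree p, (openChains ω).Finite := by
  classical
  have hmeas : ∀ q : Bool × List Bool, bondMeasure thinTree p
      {ω | ∀ i, ω (chainEdge q.1 q.2 i) = true} = ENNReal.ofReal p ^ (sqLen q.2.length + 1) := by
    intro q
    have := bondMeasure_forall_eq (p := p) true
      (Finset.univ.image (chainEdge (N := logMult) (L := sqLen) q.1 q.2))
    rw [Finset.card_image_of_injective _ (chainEdge_injective q.1 q.2), Finset.card_univ,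
      Fintype.card_fin, bernoulliMeasure_true] at this
    rw [← this]
    simp
  refine ae_finite_setOfPred_mem (s := fun q : Bool × List Bool =>
    {ω : thinTree.edgeSet → Bool | ∀ i, ω (chainEdge q.1 q.2 i) = true}) ?_
  simp only [hmeas]
  rw [ENNReal.tsum_prod', tsum_fintype]
  refine ENNReal.sum_ne_top.2 fun _ _ => ?_
  rw [← (Equiv.sigmaFiberEquiv (List.length (α := Bool))).tsum_eq, ENNReal.tsum_sigma']
  have hfib : ∀ n : ℕ, ∑' l : {l : List Bool // l.length = n},
      ENNReal.ofReal p ^ (sqLen l.1.length + 1) =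
        ENNReal.ofReal ((2 : ℝ) ^ n * (p : ℝ) ^ (sqLen n + 1)) := by
    intro n
    have h1 : ∀ l : {l : List Bool // l.length = n},
        ENNReal.ofReal p ^ (sqLen l.1.length + 1) = ENNReal.ofReal p ^ (sqLen n + 1) := by
      rintro ⟨l, rfl⟩; rfl
    have hcard : ENat.card {l : List Bool // l.length = n} = (2 ^ n : ℕ) := by
      have : Fintype.card (List.Vector Bool n) = 2 ^ n := by simp
      rw [← this]
      exact ENat.card_eq_coe_fintype_card (α := List.Vector Bool n)
    simp only [h1]
    rw [ENNReal.tsum_const, hcard, ENNReal.ofReal_mul (by positivity),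
      ENNReal.ofReal_pow p.2.1, ENNReal.ofReal_pow (by norm_num)]
    simp
  change ∑' n : ℕ, ∑' l : {l : List Bool // l.length = n},
    ENNReal.ofReal p ^ (sqLen l.1.length + 1) ≠ ∞
  simp only [hfib]
  exact (summable_openChains p.2.1 (by exact_mod_cast hp)).tsum_ofReal_ne_top

open Classical in
/-- The junction to which a vertex can still be connected when its chain is not entirely open;
vertices of the line belong to the root. -/
noncomputable def home (ω : thinTree.edgeSet → Bool) : LTVtx → List Bool
  | cut _ => []
  | mid _ _ => []
  | node b w i => if ∀ j, i < j → ω (chainEdge b w j) = true then b :: w else w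

/-- The junctions that are ends of entirely open chains or adjacent to the root. -/
def exceptional (ω : thinTree.edgeSet → Bool) : Set (List Bool) :=
  {v | v.length ≤ 1} ∪ ((fun q => q.2) '' openChains ω ∪ (fun q => q.1 :: q.2) '' openChains ω)

variable {ω : thinTree.edgeSet → Bool}

lemma home_base (w : List Bool) : home ω (base w) = w := by
  cases w with
  | nil => rfl
  | cons b w =>
    simp only [base, home]
    rw [if_pos fun j hj => absurd hj (Fin.le_last j).not_gt]

/-- `home` can change only across the first edge of a chain, and only when the rest of that chain is
open as well; both ends are then exceptional. -/
lemma home_eq_or_exceptional_of_edge {x y : LTVtx} (h : Edge x y)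
    (hopen : ω ⟨s(x, y), .inl h⟩ = true) :
    home ω x = home ω y ∨ (home ω x ∈ exceptional ω ∧ home ω y ∈ exceptional ω) := by
  cases h with
  | lo n i => exact .inl rfl
  | hi n i => exact .inl rfl
  | chain b w i =>
    have hi : ω (chainEdge b w i) = true := hopen
    obtain ⟨i, hiL⟩ := i
    cases i with
    | zero =>
      change _ = home ω (base w) ∨ _ ∧ home ω (base w) ∈ _
      rw [home_base]
      by_cases hall : ∀ j, (⟨0, hiL⟩ : Fin _) < j → ω (chainEdge b w j) = true
      · have hq : (b, w) ∈ openChains ω := by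
          intro j
          rcases (Fin.zero_le j).eq_or_lt with rfl | hj
          · exact hi
          · exact hall j hj
        right
        simp only [home]
        rw [if_pos hall]
        exact ⟨.inr (.inr ⟨_, hq, rfl⟩), .inr (.inl ⟨_, hq, rfl⟩)⟩
      · left
        simp only [home]
        rw [if_neg hall]
    | succ i =>
      left
      have e : (chainPt b w (i + 1) : LTVtx) = node b w ⟨i, by omega⟩ :=
        chainPt_succ b w ⟨i, by omega⟩
      simp only
      rw [e]
      simp only [home]
      congr 1
      refine propext ⟨fun h j hj => ?_, fun h j hj => h j (lt_trans (by simp) hj)⟩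
      rcases (show (⟨i + 1, hiL⟩ : Fin _) ≤ j from hj).eq_or_lt with rfl | hj
      · exact hi
      · exact h j hj

lemma home_eq_or_exceptional {x y : LTVtx} (h : (openGraph thinTree ω).Reachable x y) :
    home ω x = home ω y ∨ (home ω x ∈ exceptional ω ∧ home ω y ∈ exceptional ω) := by
  obtain ⟨q⟩ := h
  induction q with
  | nil => exact .inl rfl
  | @cons a b c hab _ ih =>
    have h1 : home ω a = home ω b ∨ (home ω a ∈ exceptional ω ∧ home ω b ∈ exceptional ω) := by
      obtain ⟨h | h, hω⟩ := exists_edge_of_openGraph_adj hab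
      · exact home_eq_or_exceptional_of_edge h hω
      · have := home_eq_or_exceptional_of_edge (ω := ω) h (by simpa only [Sym2.eq_swap] using hω)
        exact this.imp Eq.symm And.symm
    grind

lemma finite_exceptional (h : (openChains ω).Finite) : (exceptional ω).Finite :=
  (List.finite_length_le Bool 1).union ((h.image _).union (h.image _))

/-- The line is left out because all of its infinitely many vertices have the root as home. -/
lemma finite_home_mem {E : Set (List Bool)} (hE : E.Finite) :
    {x | x ∉ lineSet ∧ home ω x ∈ E}.Finite := by
  have h1 : (⋃ v ∈ E, ⋃ b : Bool, ((range fun i => node b v i) ∪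
      (range fun i => node b v.tail i) : Set LTVtx)).Finite :=
    hE.biUnion fun v _ => finite_iUnion fun b => (finite_range _).union (finite_range _)
  refine h1.subset ?_
  rintro x ⟨hx, hhome⟩
  cases x with
  | cut n => exact absurd (.inl ⟨n, rfl⟩) hx
  | mid n i => exact absurd (.inr ⟨n, i, rfl⟩) hx
  | node b w i =>
    have h2 : home ω (node b w i) = b :: w ∨ home ω (node b w i) = w := by
      simp only [home]
      split_ifs <;> simp
    rcases h2 with h2 | h2 <;> rw [h2] at hhome
    · exact mem_biUnion hhome (mem_iUnion.2 ⟨b, .inr ⟨i, rfl⟩⟩)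
    · exact mem_biUnion hhome (mem_iUnion.2 ⟨b, .inl ⟨i, rfl⟩⟩)

lemma mem_star_home {x : LTVtx} (hx : home ω x ≠ []) : x ∈ star (home ω x) := by
  cases x with
  | cut n => exact absurd rfl hx
  | mid n i => exact absurd rfl hx
  | node b w i =>
    refine ⟨b, w, i + 1, by omega, ?_, (chainPt_succ b w i).symm⟩
    simp only [home]
    split_ifs <;> simp

/-- If only finitely many chains are entirely open, the enlargement of a transient set is
transient. -/
lemma isTransientSubset_enlargement {A : Set LTVtx} (hA : IsTransientSubset thinTree A)
    (h : (openChains ω).Finite) :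
    IsTransientSubset thinTree (enlargement thinTree ω (inducedSubgraph thinTree A)).verts := by
  have hs := isTransientSubset_root.singleton lineTree_neighborSet_finite
    (lineTree_connected logMult_pos)
  have h1 : IsTransientSubset thinTree {y | ENNReal.ofReal (1 / 36) ≤ hit thinTree A y} :=
    hA.of_le_hit (by simp) fun x hx => hx
  have h2 := isTransientSubset_of_finite (lineTree_connected logMult_pos)
    (finite_home_mem (ω := ω) (finite_exceptional h)) hs
  refine ((h1.union h2).union isTransientSubset_lineSet).mono fun y hy => ?_
  obtain ⟨a, ha, hay⟩ := mem_enlargement_verts.1 hy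
  by_cases hyl : y ∈ lineSet
  · exact .inr hyl
  left
  by_cases hye : home ω y ∈ exceptional ω
  · exact .inr ⟨hyl, hye⟩
  left
  -- The point `a` of `A` connected to `y` has the same home, which is not the root, so both lie in
  -- one star.
  have hhome := (home_eq_or_exceptional hay).resolve_right fun h => hye h.2
  have hlen : ¬ (home ω y).length ≤ 1 := fun h => hye (.inl h)
  have hne : home ω y ≠ [] := fun h => hlen (by simp [h])
  have hys := mem_star_home hne
  have has := mem_star_home (hhome ▸ hne)
  rw [hhome] at has
  match hv : home ω y with
  | [] => exact absurd hv hne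
  | [b] => exact absurd (by simp [hv]) hlen
  | b :: c :: w =>
    rw [hv] at hys has
    exact le_hit_of_star ha has hys

lemma pc1_thinTree {A : Set LTVtx} (hA : IsTransientSubset thinTree A) :
    pc1 thinTree (inducedSubgraph thinTree A) (BeingRecurrentSubset thinTree) = 1 := by
  refine le_antisymm unitInterval.le_one' (le_sInf fun p hp => ?_)
  by_contra! hlt
  rw [mem_ofPred_eq] at hp
  refine hp.ne' ?_
  have : ∀ᵐ ω ∂bondMeasure thinTree p,
      ¬ BeingRecurrentSubset thinTree (enlargement thinTree ω (inducedSubgraph thinTree A)) := by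
    filter_upwards [ae_finite_openChains hlt] with ω hω
    exact isTransientSubset_enlargement hA hω
  simpa [ae_iff] using this

/-! ### The critical probability -/

lemma ae_frequently_cut {p : I} (hp : (p : ℝ) ≤ 1 / 2) :
    ∀ᵐ ω ∂bondMeasure thinTree p, ∃ᶠ n in atTop, ∀ i, ω (loEdge n i) = false := by
  classical
  have hinj : ∀ n, (loEdge n : Fin (logMult n) → thinTree.edgeSet).Injective := fun n i j h => by
    simpa using loEdge_inj.1 h
  have := ae_frequently_forall_eq (p := p) false
    (S := fun n => Finset.univ.image (loEdge n : Fin (logMult n) → thinTree.edgeSet)) ?_ ?_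
  · filter_upwards [this] with ω hω
    refine hω.mono fun n hn i => hn _ (by simp)
  · intro m n hmn
    rw [Finset.disjoint_left]
    intro e he he'
    simp only [Finset.mem_image, Finset.mem_univ, true_and] at he he'
    obtain ⟨i, rfl⟩ := he
    obtain ⟨j, hj⟩ := he'
    exact hmn (mid.inj (loEdge_inj.1 hj)).1.symm
  · simp only [Finset.card_image_of_injective _ (hinj _), Finset.card_univ, Fintype.card_fin,
      bernoulliMeasure_false]
    -- Since `p ≤ 1 / 2`, closing all `logMult n` edges has probability at least `2 ^ (-logMult n)`,
    -- hence at least half a harmonic term.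
    have hle : ∀ n : ℕ, ENNReal.ofReal (1 / 2 * (1 / ((n : ℝ) + 1))) ≤
        ENNReal.ofReal (1 - p) ^ logMult n := by
      intro n
      rw [← ENNReal.ofReal_pow (by linarith)]
      refine ENNReal.ofReal_le_ofReal ?_
      have h1 : (2 : ℝ) ^ Nat.log 2 (n + 1) ≤ n + 1 := by
        exact_mod_cast Nat.pow_log_le_self 2 (show n + 1 ≠ 0 by omega)
      calc 1 / 2 * (1 / ((n : ℝ) + 1)) ≤ 1 / 2 * (1 / 2 ^ Nat.log 2 (n + 1)) := by gcongr
        _ = (1 / 2) ^ logMult n := by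
          rw [logMult, pow_succ, one_div_pow, mul_comm]
        _ ≤ _ := by gcongr; linarith
    by_contra hne
    have h2 : ∑' n : ℕ, ENNReal.ofReal (1 / 2 * (1 / ((n : ℝ) + 1))) ≠ ∞ :=
      ne_top_of_le_ne_top hne (ENNReal.tsum_le_tsum hle)
    have h3 := ENNReal.summable_toReal h2
    have h4 : Summable fun n : ℕ => 1 / 2 * (1 / ((n : ℝ) + 1)) := by
      refine h3.congr fun n => ?_
      rw [ENNReal.toReal_ofReal (by positivity)]
    have h5 := (summable_mul_left_iff (by norm_num)).1 h4
    exact Real.not_summable_one_div_natCast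
      ((summable_nat_add_iff 1).1 (by simpa using h5))

/-- The cluster is trapped in a finite set closed under open edges: the line up to a blocked level
`M`, and the tree vertices whose home is exceptional or that of `x`. -/
lemma finite_cluster (hchains : (openChains ω).Finite)
    (hcut : ∃ᶠ n in atTop, ∀ i, ω (loEdge n i) = false) (x : LTVtx) :
    (cluster thinTree ω x).verts.Finite := by
  obtain ⟨m, hm⟩ : ∃ m, ∀ n, (x = cut n ∨ ∃ i, x = mid n i) → n < m := by
    cases x with
    | cut k => exact ⟨k + 1, by simp⟩
    | mid k i =>
      refine ⟨k + 1, ?_⟩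
      rintro n (h | ⟨j, h⟩)
      · simp at h
      · have := (mid.inj h).1; omega
    | node b w i => exact ⟨0, by simp⟩
  obtain ⟨M, hM, hclosed⟩ := frequently_atTop.1 hcut m
  set E : Set (List Bool) := insert (home ω x) (exceptional ω) with hE
  have hEf : E.Finite := (finite_exceptional hchains).insert _
  set S : Set LTVtx := (cut '' Iic M ∪ ⋃ n ∈ Iio M, range fun i => mid n i) ∪
    {y | y ∉ lineSet ∧ home ω y ∈ E} with hS
  have hSf : S.Finite := (((finite_Iic M).image _).union
    ((finite_Iio M).biUnion fun n _ => finite_range _)).union (finite_home_mem hEf)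
  have hcutS : ∀ n, cut n ∈ S ↔ n ≤ M := by
    intro n
    simp [hS, lineSet]
  have hmidS : ∀ n i, mid n i ∈ S ↔ n < M := by
    intro n i
    simp only [hS, mem_union, mem_image, mem_Iic, reduceCtorEq, and_false, exists_false, false_or,
      mem_iUnion, mem_Iio, mem_range, mem_ofPred_eq, lineSet]
    constructor
    · rintro (⟨k, hk, j, h⟩ | ⟨h, -⟩)
      · rw [← (mid.inj h).1]; exact hk
      · exact absurd ⟨n, i, rfl⟩ h
    · exact fun h => .inl ⟨n, h, i, rfl⟩
  have hnodeS : ∀ b w i, node b w i ∈ S ↔ home ω (node b w i) ∈ E := by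
    intro b w i
    simp [hS, lineSet]
  have hx : x ∈ S := by
    cases x with
    | cut n => exact (hcutS n).2 ((hm n (.inl rfl)).le.trans hM)
    | mid n i => exact (hmidS n i).2 ((hm n (.inr ⟨i, rfl⟩)).trans_le hM)
    | node b w i => exact (hnodeS b w i).2 (mem_insert _ _)
  have hbaseS : ∀ w, base w ∈ S ↔ w ∈ E := by
    intro w
    cases w with
    | nil =>
      change cut 0 ∈ S ↔ _
      rw [hcutS]
      -- The empty address is exceptional by definition, which makes the line and tree parts of `S`
      -- agree at the root.
      exact iff_of_true (Nat.zero_le _) (.inr (.inl (by simp)))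
    | cons b w =>
      change node b w (Fin.last _) ∈ S ↔ _
      rw [hnodeS]
      change home ω (base (b :: w)) ∈ E ↔ _
      rw [home_base]
  have hstep : ∀ a b, (h : Edge a b) → ω ⟨s(a, b), .inl h⟩ = true → (a ∈ S ↔ b ∈ S) := by
    intro a b h hopen
    have hhome := home_eq_or_exceptional_of_edge h hopen
    have hhomeE : home ω a ∈ E ↔ home ω b ∈ E := by
      rcases hhome with h | ⟨h1, h2⟩
      · rw [h]
      · exact iff_of_true (.inr h1) (.inr h2)
    cases h with
    | lo n i =>
      rw [hmidS, hcutS]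
      refine ⟨le_of_lt, fun h => h.lt_of_ne ?_⟩
      rintro rfl
      have h1 : ω (loEdge n i) = true := hopen
      rw [hclosed i] at h1
      exact absurd h1 (by simp)
    | hi n i =>
      rw [hmidS, hcutS]; rfl
    | chain b w i =>
      rw [hnodeS, hhomeE]
      obtain ⟨i, hi⟩ := i
      cases i with
      | zero =>
        change home ω (base w) ∈ E ↔ base w ∈ S
        rw [home_base, hbaseS]
      | succ i => exact (hnodeS b w _).symm
  refine hSf.subset (reachable_subset_of_closed hx fun a b hab ha => ?_)
  obtain ⟨h | h, hω⟩ := exists_edge_of_openGraph_adj hab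
  · exact (hstep a b h hω).1 ha
  · exact (hstep b a h (by simpa only [Sym2.eq_swap] using hω)).2 ha

lemma criticalProb_thinTree_pos : 0 < criticalProb thinTree := by
  have hhalf : (1 / 2 : ℝ) ∈ Icc (0 : ℝ) 1 := by constructor <;> norm_num
  have : (⟨1 / 2, hhalf⟩ : I) ≤ criticalProb thinTree := by
    refine le_sInf ?_
    rintro p ⟨-, hp1, x, hx⟩
    by_contra! hlt
    refine hx.ne' ?_
    have : ∀ᵐ ω ∂bondMeasure thinTree p, ¬ (cluster thinTree ω x).verts.Infinite := by
      filter_upwards [ae_finite_openChains hp1,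
        ae_frequently_cut (show (p : ℝ) ≤ 1 / 2 from le_of_lt hlt)] with ω h1 h2
      exact not_infinite.2 (finite_cluster h1 h2 x)
    simpa [ae_iff] using this
  refine lt_of_lt_of_le ?_ this
  rw [← Subtype.coe_lt_coe]
  norm_num

lemma ae_eventually_linked {p : I} (hp : 7 / 8 ≤ (p : ℝ)) :
    ∀ᵐ ω ∂bondMeasure thinTree p,
      ∀ᶠ n in atTop, ∃ i, ω (loEdge n i) = true ∧ ω (hiEdge n i) = true := by
  classical
  have hbound : ∀ n, bondMeasure thinTree p
      {ω | ∀ i, ω (loEdge n i) = false ∨ ω (hiEdge n i) = false} ≤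
        ENNReal.ofReal ((1 / 4) ^ logMult n) := by
    intro n
    -- If a level is not linked, choose a closed edge on each path. A union bound over the `2 ^
    -- logMult n` choices gives `(2 * (1 - p)) ^ logMult n`, and `p ≥ 7 / 8` makes the base at most
    -- `1 / 4`.
    let φ : (Fin (logMult n) → Bool) → Fin (logMult n) → thinTree.edgeSet :=
      fun t i => if t i then loEdge n i else hiEdge n i
    have hφ : ∀ t, (φ t).Injective := by
      intro t i j h
      simp only [φ] at h
      split_ifs at h
      · simpa using loEdge_inj.1 h
      · exact absurd h loEdge_ne_hiEdge
      · exact absurd h.symm loEdge_ne_hiEdge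
      · exact hiEdge_inj.1 h
    have hsub : {ω : thinTree.edgeSet → Bool |
        ∀ i, ω (loEdge n i) = false ∨ ω (hiEdge n i) = false} ⊆
          ⋃ t, {ω | ∀ e ∈ Finset.univ.image (φ t), ω e = false} := by
      intro ω hω
      refine mem_iUnion.2 ⟨fun i => !ω (loEdge n i), ?_⟩
      simp only [mem_ofPred_eq, Finset.mem_image, Finset.mem_univ, true_and, forall_exists_index,
        forall_apply_eq_imp_iff, φ]
      intro i
      rcases hω i with h | h
      · simp [h]
      · by_cases h2 : ω (loEdge n i) = false
        · simp [h2]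
        · simp [h, h2]
    calc _ ≤ ∑ t, bondMeasure thinTree p {ω | ∀ e ∈ Finset.univ.image (φ t), ω e = false} :=
          (measure_mono hsub).trans (measure_iUnion_fintype_le _ _)
      _ = 2 ^ logMult n * ENNReal.ofReal (1 - p) ^ logMult n := by
          simp only [bondMeasure_forall_eq, Finset.card_image_of_injective _ (hφ _),
            Finset.card_univ, Fintype.card_fin, bernoulliMeasure_false, Finset.sum_const,
            Fintype.card_pi, Fintype.card_bool, Finset.prod_const, nsmul_eq_mul]
          push_cast
          rfl
      _ = ENNReal.ofReal ((2 * (1 - p)) ^ logMult n) := by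
          rw [← mul_pow, ENNReal.ofReal_pow (by linarith [p.2.2]),
            ENNReal.ofReal_mul (by norm_num)]
          simp
      _ ≤ _ := by
          refine ENNReal.ofReal_le_ofReal (pow_le_pow_left₀ (by linarith [p.2.2]) ?_ _)
          linarith
  have hsum : Summable fun n : ℕ => (1 / 4 : ℝ) ^ logMult n := by
    have h1 : Summable fun n : ℕ => 1 / ((n : ℝ) + 1) ^ 2 := by
      have := (summable_nat_add_iff 1).2 (Real.summable_one_div_nat_pow.2 one_lt_two)
      simpa using this
    refine h1.of_nonneg_of_le (fun n => by positivity) fun n => ?_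
    have h2 : ((n : ℝ) + 1) ≤ 2 ^ logMult n := by
      exact_mod_cast (Nat.lt_pow_succ_log_self one_lt_two (n + 1)).le
    calc (1 / 4 : ℝ) ^ logMult n = 1 / (2 ^ logMult n) ^ 2 := by
          rw [one_div_pow, ← pow_mul, mul_comm, pow_mul]; norm_num
      _ ≤ _ := by gcongr
  have hfin := ae_finite_setOfPred_mem (μ := bondMeasure thinTree p) (s := fun n =>
    {ω : thinTree.edgeSet → Bool | ∀ i, ω (loEdge n i) = false ∨ ω (hiEdge n i) = false})
    (ne_top_of_le_ne_top hsum.tsum_ofReal_ne_top (ENNReal.tsum_le_tsum hbound))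
  filter_upwards [hfin] with ω hω
  have h1 := Nat.cofinite_eq_atTop ▸ hω.eventually_cofinite_notMem
  filter_upwards [h1] with n hn
  simp only [not_forall, not_or, Bool.not_eq_false] at hn
  exact hn

lemma criticalProb_thinTree_lt_one : criticalProb thinTree < 1 := by
  have hmem : (7 / 8 : ℝ) ∈ Icc (0 : ℝ) 1 := by constructor <;> norm_num
  let p : I := ⟨7 / 8, hmem⟩
  have hp0 : 0 < p := by rw [← Subtype.coe_lt_coe]; norm_num [p]
  have hp1 : p < 1 := by rw [← Subtype.coe_lt_coe]; norm_num [p]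
  refine lt_of_le_of_lt (sInf_le ⟨hp0, hp1, ?_⟩) hp1
  by_contra! hzero
  -- The level from which all levels are linked is random, so all cut points are excluded
  -- simultaneously.
  have hnone : ∀ᵐ ω ∂bondMeasure thinTree p, ∀ n,
      ¬ (cluster thinTree ω (cut n)).verts.Infinite := by
    rw [ae_all_iff]
    intro n
    simpa [ae_iff] using hzero (cut n)
  obtain ⟨ω, h1, h2⟩ := (hnone.and (ae_eventually_linked (p := p) le_rfl)).exists
  obtain ⟨m, hm⟩ := eventually_atTop.1 h2
  refine h1 m ?_
  have hreach : ∀ n, m ≤ n → (openGraph thinTree ω).Reachable (cut m) (cut n) := by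
    intro n hn
    induction n, hn using Nat.le_induction with
    | base => rfl
    | succ n hn ih =>
      obtain ⟨i, hlo, hhi⟩ := hm n hn
      have e1 : (openGraph thinTree ω).Adj (mid n i) (cut n) := ⟨(loEdge n i).2, hlo⟩
      have e2 : (openGraph thinTree ω).Adj (mid n i) (cut (n + 1)) := ⟨(hiEdge n i).2, hhi⟩
      exact ih.trans (e1.symm.reachable.trans e2.reachable)
  refine ((Ici_infinite m).image (f := (cut : ℕ → LTVtx)) fun a _ b _ h => by simpa using h).mono ?_
  rintro _ ⟨n, hn, rfl⟩
  exact hreach n hn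

theorem exists_pc1_eq_one : ∃ (V : Type) (G : SimpleGraph V), IsAdmissible G ∧
    ∀ A : Set V, IsTransientSubset G A →
      0 < criticalProb G ∧
      criticalProb G < pc1 G (inducedSubgraph G A) (BeingRecurrentSubset G) ∧
      pc1 G (inducedSubgraph G A) (BeingRecurrentSubset G) = 1 := by
  refine ⟨_, thinTree, isAdmissible_lineTree logMult_pos isTransientSubset_root, fun A hA => ?_⟩
  rw [pc1_thinTree hA]
  exact ⟨criticalProb_thinTree_pos, criticalProb_thinTree_lt_one, rfl⟩

end Enlargement

theorem mainTheorem9 :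
    (∃ (V : Type) (G : SimpleGraph V), Enlargement.IsAdmissible G ∧
      ∀ A : Set V, Enlargement.IsTransientSubset G A →
        0 < Enlargement.criticalProb G ∧
        Enlargement.criticalProb G <
          Enlargement.pc1 G (Enlargement.inducedSubgraph G A)
            (Enlargement.BeingRecurrentSubset G) ∧
        Enlargement.pc1 G (Enlargement.inducedSubgraph G A)
          (Enlargement.BeingRecurrentSubset G) = 1) ∧
    (∃ (V : Type) (G : SimpleGraph V), Enlargement.IsAdmissible G ∧
      (∃ A : Set V, A.Infinite ∧ Enlargement.IsTransientSubset G A) ∧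
      ∀ A : Set V, A.Infinite → Enlargement.IsTransientSubset G A →
        Enlargement.pc2 G (Enlargement.inducedSubgraph G A)
          (Enlargement.BeingRecurrentSubset G) = 0) :=
  ⟨Enlargement.exists_pc1_eq_one, Enlargement.exists_pc2_eq_zero⟩
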